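/- Let $F$ be the distribution function of the standard normal distribution. Let $p,q\ge 1$, $k=p+q$, let $(n_i)_{i\ge1}$ be a bounded sequence of integers $n_i\ge 1$, and let $(Y_i,\mathbf X_i,\mathbf W_i)$, $i\ge 1$, be independent random elements of $\mathbb N\times\mathbb R^p\times\mathbb R^q$ on a probability space, where $\mathbf X_i=(1,X_{i2},\dots,X_{ip})'$, $\mathbf W_i=(1,W_{i2},\dots,W_{iq})'$, and the pairs $(\mathbf X_i,\mathbf W_i)$ are identically distributed. Let $\theta_0=(\beta_0',\mu_0')'\in\mathbb R^{p}\times\mathbb R^q$ and suppose that, conditionally on $(\mathbf X_i,\mathbf W_i)$, $Y_i$ is zero-inflated binomial with probit links: for every $y\in\mathbb N$, almost surely $$\mathbb P(Y_i=y\mid \mathbf X_i,\mathbf W_i)=P_{n_i}\big(y;\,\beta_0'\mathbf X_i,\mu_0'\mathbf W_i\big),\qquad P_m(y;a,b)=F(a)\mathbf 1_{\{y=0\}}+(1-F(a))\binom{m}{y}F(b)^y(1-F(b))^{m-y}.$$ For $\theta=(\beta',\mu')'$ let $l_n(\theta)=\log\prod_{i=1}^nP_{n_i}(Y_i;\beta'\mathbf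 X_i,\mu'\mathbf W_i)$ be the log-likelihood, $\dot l_n$ its gradient and $\ddot l_n$ its Hessian matrix. Let $\mathbb Z=\begin{bmatrix}\mathbb X&0\\0&\mathbb W\end{bmatrix}$ be the $k\times 2n$ matrix in which $\mathbb X$ and $\mathbb W$ have columns $\mathbf X_1,\dots,\mathbf X_n$ and $\mathbf W_1,\dots,\mathbf W_n$, and let $\mathbf D(\theta)=\begin{bmatrix}\mathbf D_1&\mathbf D_3\\\mathbf D_3&\mathbf D_2\end{bmatrix}$, where $\mathbf D_1,\mathbf D_2,\mathbf D_3$ are $n\times n$ diagonal matrices whose $i$-th diagonal entries are $-\partial_a^2$, $-\partial_b^2$ and $-\partial_a\partial_b$ of $\log P_{n_i}(Y_i;a,b)$ at $(a,b)=(\beta'\mathbf X_i,\mu'\mathbf W_i)$, so that $\ddot l_n(\theta)=-\mathbb Z\mathbf D(\theta)\mathbb Z'$. Assume: (C1) There are compact sets $G\subset\mathbb R^p$, $H\subset\mathbb R^q$ with $\mathbf X_i\in G$ and $\mathbf W_i\in H$ almost surely for every $i$; $\operatorname{var}(X_{ij})>0$ and $\operatorname{var}(W_{ij'})>0$ for all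 $i$ and all $j,j'\ge2$; for every $i$ the random variables $X_{i1},\dots,X_{ip}$ are linearly independent (no non-trivial linear combination vanishes almost surely), and so are $W_{i1},\dots,W_{iq}$. (C2) $\beta_0$ and $\mu_0$ lie in the interior of compact subsets of $\mathbb R^p$ and $\mathbb R^q$, respectively. (C3) There is a constant $0<c_2<\infty$ such that, almost surely, for all sufficiently large $n$, $\ddot l_n(\theta_0)$ is negative definite and $\Lambda_n/\lambda_n<c_2$, where $\lambda_n$ and $\Lambda_n$ are the smallest and the largest eigenvalue of $\mathbb Z\mathbf D(\theta_0)\mathbb Z'$. Let $\widehat\theta_n$, $n\ge1$, be random vectors in $\mathbb R^k$ such that, almost surely, $\dot l_n(\widehat\theta_n)=0$ for all sufficiently large $n$ (maximum likelihood estimators, in the sense of the score equation), and suppose that $\widehat\theta_n\to\theta_0$ almost surely. Let $\widehat\Sigma_n=\mathbb Z\mathbf D(\widehat\theta_n)\mathbb Z'$ be the observed information matrix and $\widehat\Sigma_n^{1/2}$ its positive semidefinite square root (set to $0$ when $\widehat\Sigma_n$ is not positive semidefinite). Then, as $n\to\infty$, $$\widehat\Sigma_n^{1/2}(\widehat\theta_n-\theta_0)\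 \longrightarrow\ \mathcal N(0,I_k)\quad\text{in distribution.}$$ -/

import Mathlib

open MeasureTheory ProbabilityTheory Filter Topology
open scoped MatrixOrder

noncomputable section

namespace ProbitZIB

/-- The cumulative distribution function of the standard normal distribution. -/
def stdNormalCDF (t : ℝ) : ℝ := cdf (gaussianReal 0 1) t

/-- Probability of the value `y` under the zero-inflated binomial distribution: a structural zero
with probability `zeroProb`, and a binomial variable with `m` trials and success probability
`succProb` with probability `1 - zeroProb`. -/
def zibProb (m : ℕ) (zeroProb succProb : ℝ) (y : ℕ) : ℝ :=
  (if y = 0 then zeroProb else 0)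
    + (1 - zeroProb) * ((m.choose y : ℝ) * succProb ^ y * (1 - succProb) ^ (m - y))

/-- The parameter space: `θ = (β, μ)` with `β ∈ ℝ^p` and `μ ∈ ℝ^q`, Euclidean norm. -/
abbrev Param (p q : ℕ) : Type := EuclideanSpace ℝ (Fin p ⊕ Fin q)

variable {p q : ℕ}

/-- The component `β` of `θ = (β, μ)`. -/
def betaPart (θ : Param p q) : EuclideanSpace ℝ (Fin p) := WithLp.toLp 2 fun j => θ (Sum.inl j)

/-- The component `μ` of `θ = (β, μ)`. -/
def muPart (θ : Param p q) : EuclideanSpace ℝ (Fin q) := WithLp.toLp 2 fun j => θ (Sum.inr j)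

/-- The linear predictor `β' x` of the zero-inflation component. -/
def zeroPredictor (θ : Param p q) (x : EuclideanSpace ℝ (Fin p)) : ℝ := ∑ j, betaPart θ j * x j

/-- The linear predictor `μ' w` of the binomial component. -/
def binomPredictor (θ : Param p q) (w : EuclideanSpace ℝ (Fin q)) : ℝ := ∑ j, muPart θ j * w j

/-- The conditional probability of the response `y` out of `m` trials given the covariates `x`
and `w`, in the model with probit links and parameter `θ`. -/
def modelProb (m : ℕ) (θ : Param p q) (x : EuclideanSpace ℝ (Fin p))
    (w : EuclideanSpace ℝ (Fin q)) (y : ℕ) : ℝ :=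
  zibProb m (stdNormalCDF (zeroPredictor θ x)) (stdNormalCDF (binomPredictor θ w)) y

/-! In what follows `m`, `y`, `x`, `w` are the sequences of trial numbers, responses and
covariates; a sample of size `n` consists of the indices `i < n`. -/

/-- The likelihood of a sample of size `n`. -/
def likelihood (m y : ℕ → ℕ) (x : ℕ → EuclideanSpace ℝ (Fin p)) (w : ℕ → EuclideanSpace ℝ (Fin q))
    (n : ℕ) (θ : Param p q) : ℝ :=
  ∏ i : Fin n, modelProb (m i) θ (x i) (w i) (y i)

/-- The log-likelihood of a sample of size `n`. -/
def logLikelihood (m y : ℕ → ℕ) (x : ℕ → EuclideanSpace ℝ (Fin p))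
    (w : ℕ → EuclideanSpace ℝ (Fin q)) (n : ℕ) (θ : Param p q) : ℝ :=
  Real.log (likelihood m y x w n θ)

/-- The score: the gradient of the log-likelihood. -/
def score (m y : ℕ → ℕ) (x : ℕ → EuclideanSpace ℝ (Fin p)) (w : ℕ → EuclideanSpace ℝ (Fin q))
    (n : ℕ) (θ : Param p q) : Param p q :=
  gradient (logLikelihood m y x w n) θ

/-- The Hessian matrix of the log-likelihood. -/
def hessian (m y : ℕ → ℕ) (x : ℕ → EuclideanSpace ℝ (Fin p)) (w : ℕ → EuclideanSpace ℝ (Fin q))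
    (n : ℕ) (θ : Param p q) : Matrix (Fin p ⊕ Fin q) (Fin p ⊕ Fin q) ℝ :=
  Matrix.of fun a b => iteratedFDeriv ℝ 2 (logLikelihood m y x w n) θ
    ![EuclideanSpace.single a 1, EuclideanSpace.single b 1]

/-- The log-likelihood contribution of one observation `y` out of `m` trials, as a function of
the values `a = β' x` and `b = μ' w` of the two linear predictors. -/
def obsLogLik (m y : ℕ) (a b : ℝ) : ℝ := Real.log (zibProb m (stdNormalCDF a) (stdNormalCDF b) y)

/-- The block matrix `ℤ = [𝕏, 0; 0, 𝕎]`, of size `(p + q) × 2n`; column `i` of `𝕏`, `𝕎` is the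
covariate vector of observation `i`. -/
def designMatrix (x : ℕ → EuclideanSpace ℝ (Fin p)) (w : ℕ → EuclideanSpace ℝ (Fin q)) (n : ℕ) :
    Matrix (Fin p ⊕ Fin q) (Fin n ⊕ Fin n) ℝ :=
  Matrix.fromBlocks (Matrix.of fun j i => x i j) 0 0 (Matrix.of fun j i => w i j)

/-- The block matrix `D(θ) = [D₁, D₃; D₃, D₂]`, of size `2n × 2n`, with diagonal blocks: the
`i`-th diagonal entries of `D₁`, `D₂`, `D₃` are minus the second derivatives `∂²/∂a²`, `∂²/∂b²`,
`∂²/∂a∂b` of the `i`-th log-likelihood contribution, at `a = β' xᵢ`, `b = μ' wᵢ`. Thus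
`ℤ D(θ) ℤ'` is minus the Hessian of the log-likelihood. -/
def weightMatrix (m y : ℕ → ℕ) (x : ℕ → EuclideanSpace ℝ (Fin p))
    (w : ℕ → EuclideanSpace ℝ (Fin q)) (n : ℕ) (θ : Param p q) :
    Matrix (Fin n ⊕ Fin n) (Fin n ⊕ Fin n) ℝ :=
  let D₁ : Fin n → ℝ := fun i =>
    -iteratedDeriv 2 (fun a => obsLogLik (m i) (y i) a (binomPredictor θ (w i)))
      (zeroPredictor θ (x i))
  let D₂ : Fin n → ℝ := fun i =>
    -iteratedDeriv 2 (fun b => obsLogLik (m i) (y i) (zeroPredictor θ (x i)) b)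
      (binomPredictor θ (w i))
  let D₃ : Fin n → ℝ := fun i =>
    -deriv (fun a => deriv (fun b => obsLogLik (m i) (y i) a b) (binomPredictor θ (w i)))
      (zeroPredictor θ (x i))
  Matrix.fromBlocks (Matrix.diagonal D₁) (Matrix.diagonal D₃)
    (Matrix.diagonal D₃) (Matrix.diagonal D₂)

/-- The observed information matrix `Σ_n(θ) = ℤ D(θ) ℤ'`. -/
def observedInfo (m y : ℕ → ℕ) (x : ℕ → EuclideanSpace ℝ (Fin p))
    (w : ℕ → EuclideanSpace ℝ (Fin q)) (n : ℕ) (θ : Param p q) :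
    Matrix (Fin p ⊕ Fin q) (Fin p ⊕ Fin q) ℝ :=
  designMatrix x w n * weightMatrix m y x w n θ * (designMatrix x w n).transpose

/-- The smallest eigenvalue of a (real symmetric) matrix. -/
def minEigenvalue {ι : Type*} [Fintype ι] [DecidableEq ι] (M : Matrix ι ι ℝ) : ℝ :=
  sInf (spectrum ℝ M)

/-- The largest eigenvalue of a (real symmetric) matrix. -/
def maxEigenvalue {ι : Type*} [Fintype ι] [DecidableEq ι] (M : Matrix ι ι ℝ) : ℝ :=
  sSup (spectrum ℝ M)

variable {Ω : Type*} [MeasurableSpace Ω]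

/-- `(Yᵢ, Xᵢ, Wᵢ)`, `i = 0, 1, …`, are independent observations from the zero-inflated binomial
regression model with probit links, trial numbers `mᵢ` and true parameter `θ₀`, with identically
distributed covariates whose first coordinates are the constant `1`. -/
structure IsSample [NeZero p] [NeZero q] (P : Measure Ω) (m : ℕ → ℕ) (Y : ℕ → Ω → ℕ)
    (X : ℕ → Ω → EuclideanSpace ℝ (Fin p)) (W : ℕ → Ω → EuclideanSpace ℝ (Fin q))
    (θ₀ : Param p q) : Prop where
  measurable_Y : ∀ i, Measurable (Y i)
  measurable_X : ∀ i, Measurable (X i)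
  measurable_W : ∀ i, Measurable (W i)
  intercept_X : ∀ i ω, X i ω 0 = 1
  intercept_W : ∀ i ω, W i ω 0 = 1
  indep : iIndepFun (fun i ω => (Y i ω, X i ω, W i ω)) P
  identDistrib : ∀ i, IdentDistrib (fun ω => (X i ω, W i ω)) (fun ω => (X 0 ω, W 0 ω)) P P
  trials_pos : ∀ i, 1 ≤ m i
  trials_bdd : ∃ M, ∀ i, m i ≤ M
  condProb : ∀ i y,
    P⟦Y i ⁻¹' {y} | MeasurableSpace.comap (fun ω => (X i ω, W i ω)) inferInstance⟧
      =ᵐ[P] fun ω => modelProb (m i) θ₀ (X i ω) (W i ω) y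

/-- Random covariate vectors `Vᵢ` in `ℝ^r` that are bounded uniformly in `i`, with non-constant
coordinates (apart from the intercept) and with linearly independent coordinates. -/
structure RegularCovariates {r : ℕ} [NeZero r] (P : Measure Ω)
    (V : ℕ → Ω → EuclideanSpace ℝ (Fin r)) : Prop where
  bounded : ∃ K : Set (EuclideanSpace ℝ (Fin r)), IsCompact K ∧ ∀ i, ∀ᵐ ω ∂P, V i ω ∈ K
  variance_pos : ∀ i, ∀ j : Fin r, j ≠ 0 → 0 < Var[fun ω => V i ω j; P]
  linearIndep : ∀ i, ∀ u : Fin r → ℝ, (∀ᵐ ω ∂P, ∑ j, u j * V i ω j = 0) → u = 0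

/-- The two components of the true parameter lie in the interior of compact sets. -/
def InteriorParam (θ₀ : Param p q) : Prop :=
  (∃ 𝒢 : Set (EuclideanSpace ℝ (Fin p)), IsCompact 𝒢 ∧ betaPart θ₀ ∈ interior 𝒢) ∧
  (∃ ℋ : Set (EuclideanSpace ℝ (Fin q)), IsCompact ℋ ∧ muPart θ₀ ∈ interior ℋ)

/-- Almost surely, for all large `n`, the Hessian of the log-likelihood at `θ₀` is negative
definite and the condition number of `ℤ D(θ₀) ℤ'` is less than a constant `c₂`. -/
def WellConditioned (P : Measure Ω) (m : ℕ → ℕ) (Y : ℕ → Ω → ℕ)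
    (X : ℕ → Ω → EuclideanSpace ℝ (Fin p)) (W : ℕ → Ω → EuclideanSpace ℝ (Fin q))
    (θ₀ : Param p q) : Prop :=
  ∃ c₂ : ℝ, 0 < c₂ ∧ ∀ᵐ ω ∂P, ∀ᶠ n in atTop,
    (-hessian m (Y · ω) (X · ω) (W · ω) n θ₀).PosDef ∧
    maxEigenvalue (observedInfo m (Y · ω) (X · ω) (W · ω) n θ₀) /
      minEigenvalue (observedInfo m (Y · ω) (X · ω) (W · ω) n θ₀) < c₂

/-- `θhat n` is a maximum likelihood estimator in the sense of the score equation: random vectors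
that, almost surely, solve the score equation for all large `n`. -/
structure IsScoreEstimator (P : Measure Ω) (m : ℕ → ℕ) (Y : ℕ → Ω → ℕ)
    (X : ℕ → Ω → EuclideanSpace ℝ (Fin p)) (W : ℕ → Ω → EuclideanSpace ℝ (Fin q))
    (θhat : ℕ → Ω → Param p q) : Prop where
  measurable : ∀ n, Measurable (θhat n)
  score_eq_zero : ∀ᵐ ω ∂P, ∀ᶠ n in atTop, score m (Y · ω) (X · ω) (W · ω) n (θhat n ω) = 0

/-- The normalized estimator `Σ̂_n^{1/2} (θ̂_n - θ₀)`, where `Σ̂_n = ℤ D(θ̂_n) ℤ'` and the square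
root is the positive semidefinite one (it is `0` by convention if `Σ̂_n` is not positive
semidefinite). -/
def normalizedEstimator (m : ℕ → ℕ) (Y : ℕ → Ω → ℕ)
    (X : ℕ → Ω → EuclideanSpace ℝ (Fin p)) (W : ℕ → Ω → EuclideanSpace ℝ (Fin q))
    (θ₀ : Param p q) (θhat : ℕ → Ω → Param p q) (n : ℕ) (ω : Ω) : Param p q :=
  Matrix.toEuclideanCLM (𝕜 := ℝ)
    (CFC.sqrt (observedInfo m (Y · ω) (X · ω) (W · ω) n (θhat n ω))) (θhat n ω - θ₀)

end ProbitZIB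

end

noncomputable section

namespace ProbitZIB

/-! ### Real symmetric matrices as operators on Euclidean space -/

section Matrices

open Matrix
open scoped RealInnerProductSpace

variable {ι : Type*} [Fintype ι] [DecidableEq ι]

/-! Write S for the score at θ₀, V for the Fisher information `fisherInfo`, A for the observed
information at θ̂, and h = θ̂ - θ₀. The scores of single observations are independent, bounded and
centred, and by the information equality V is the covariance matrix of S. If V ≥ c n for some c > 0,
a comparison of characteristic functions gives V^(-1/2) S → N(0, I)
(`IsSample.tendstoInDistribution_trueScore`).

The bound V ≥ c n is where (C3) enters (`IsSample.exists_eventually_le_inner_fisherInfo`). In the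
direction of the zero-inflation intercept, the outcome y = 0 alone carries a positive amount of
information per observation, so V has an eigenvalue of order n. By the weak law of large numbers the
observed information at θ₀ is within o(n) of V in probability. The bound on its condition number
then forces its smallest eigenvalue, and hence that of V, to be of order n.

The score vanishes at θ̂. Consistency, together with uniform continuity of the second derivatives
over bounded covariates, gives S = A h + o(n ‖h‖) and shows that A differs from the observed
information at θ₀ by o(n). So A is within o(n) of V in probability. Matrix square roots are Hölder
continuous of order 1/2, and therefore √A h - V^(-1/2) S → 0 in probability
(`norm_sqrt_apply_sub_le`, `IsSample.tendstoInMeasure_normalizedEstimator_sub`). No rate for h is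
assumed: the linearization itself bounds ‖h‖ by a multiple of ‖S‖ / n, and ‖S‖ / √n is bounded in
probability. Slutsky's theorem concludes. -/

theorem inner_toEuclideanCLM_comm {M : Matrix ι ι ℝ} (hM : M.IsHermitian)
    (x y : EuclideanSpace ℝ ι) :
    ⟪toEuclideanCLM (𝕜 := ℝ) M x, y⟫ = ⟪x, toEuclideanCLM (𝕜 := ℝ) M y⟫ := by
  have h : ContinuousLinearMap.adjoint (toEuclideanCLM (𝕜 := ℝ) M) = toEuclideanCLM (𝕜 := ℝ) M := by
    rw [← ContinuousLinearMap.star_eq_adjoint, ← map_star, star_eq_conjTranspose, hM.eq]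
  rw [← ContinuousLinearMap.adjoint_inner_right, h]

theorem posSemidef_iff_inner {M : Matrix ι ι ℝ} :
    M.PosSemidef ↔
      M.IsHermitian ∧ ∀ x : EuclideanSpace ℝ ι, 0 ≤ ⟪x, toEuclideanCLM (𝕜 := ℝ) M x⟫ := by
  rw [posSemidef_iff_dotProduct_mulVec]
  refine and_congr_right fun _ => ⟨fun h x => ?_, fun h x => ?_⟩
  · rw [inner_toEuclideanCLM]; simpa using h x
  · have := h (WithLp.toLp 2 x)
    rw [inner_toEuclideanCLM] at this
    simpa using this

theorem toEuclideanCLM_eigenvectorBasis {M : Matrix ι ι ℝ} (hM : M.IsHermitian) (j : ι) :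
    toEuclideanCLM (𝕜 := ℝ) M (hM.eigenvectorBasis j) =
      hM.eigenvalues j • hM.eigenvectorBasis j := by
  apply (WithLp.ofLp_injective 2)
  rw [ofLp_toEuclideanCLM, hM.mulVec_eigenvectorBasis]
  simp

theorem inner_eigenvectorBasis_toEuclideanCLM {M : Matrix ι ι ℝ} (hM : M.IsHermitian) (j : ι)
    (x : EuclideanSpace ℝ ι) :
    ⟪hM.eigenvectorBasis j, toEuclideanCLM (𝕜 := ℝ) M x⟫ =
      hM.eigenvalues j * ⟪hM.eigenvectorBasis j, x⟫ := by
  rw [← inner_toEuclideanCLM_comm hM, toEuclideanCLM_eigenvectorBasis, real_inner_smul_left]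

theorem inner_toEuclideanCLM_eq_sum_eigenvalues {M : Matrix ι ι ℝ} (hM : M.IsHermitian)
    (x : EuclideanSpace ℝ ι) :
    ⟪x, toEuclideanCLM (𝕜 := ℝ) M x⟫ =
      ∑ j, hM.eigenvalues j * ⟪hM.eigenvectorBasis j, x⟫ ^ 2 := by
  rw [← hM.eigenvectorBasis.sum_inner_mul_inner]
  refine Finset.sum_congr rfl fun j _ => ?_
  rw [inner_eigenvectorBasis_toEuclideanCLM, real_inner_comm x]
  ring

/-- Parseval in an orthonormal eigenbasis, where M multiplies each coordinate by an eigenvalue. -/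
theorem norm_toEuclideanCLM_le_of_eigenvalues {M : Matrix ι ι ℝ} (hM : M.IsHermitian) {C : ℝ}
    (hC : 0 ≤ C) (h : ∀ j, |hM.eigenvalues j| ≤ C) : ‖toEuclideanCLM (𝕜 := ℝ) M‖ ≤ C := by
  refine ContinuousLinearMap.opNorm_le_bound _ hC fun x => ?_
  rw [← sq_le_sq₀ (norm_nonneg _) (by positivity), mul_pow,
    ← hM.eigenvectorBasis.sum_sq_norm_inner_right, ← hM.eigenvectorBasis.sum_sq_norm_inner_right x,
    Finset.mul_sum]
  refine Finset.sum_le_sum fun j _ => ?_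
  rw [inner_eigenvectorBasis_toEuclideanCLM, norm_mul, mul_pow]
  gcongr
  exact h j

theorem minEigenvalue_mul_norm_sq_le_inner {M : Matrix ι ι ℝ} (hM : M.IsHermitian)
    (x : EuclideanSpace ℝ ι) :
    minEigenvalue M * ‖x‖ ^ 2 ≤ ⟪x, toEuclideanCLM (𝕜 := ℝ) M x⟫ := by
  rw [inner_toEuclideanCLM_eq_sum_eigenvalues hM, ← hM.eigenvectorBasis.sum_sq_norm_inner_right x,
    Finset.mul_sum]
  refine Finset.sum_le_sum fun j _ => ?_
  rw [Real.norm_eq_abs, sq_abs]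
  gcongr
  -- The spectrum is finite, so the infimum is a genuine lower bound and not a default value of
  -- `sInf`.
  exact csInf_le (finite_real_spectrum (A := M)).bddBelow (hM.eigenvalues_mem_spectrum_real j)

theorem inner_le_maxEigenvalue_mul_norm_sq {M : Matrix ι ι ℝ} (hM : M.IsHermitian)
    (x : EuclideanSpace ℝ ι) :
    ⟪x, toEuclideanCLM (𝕜 := ℝ) M x⟫ ≤ maxEigenvalue M * ‖x‖ ^ 2 := by
  rw [inner_toEuclideanCLM_eq_sum_eigenvalues hM, ← hM.eigenvectorBasis.sum_sq_norm_inner_right x,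
    Finset.mul_sum]
  refine Finset.sum_le_sum fun j _ => ?_
  rw [Real.norm_eq_abs, sq_abs]
  gcongr
  exact le_csSup (finite_real_spectrum (A := M)).bddAbove (hM.eigenvalues_mem_spectrum_real j)

/-- `Nonempty ι` matters: over an empty index type the spectrum is empty and `sInf` returns 0. -/
theorem minEigenvalue_pos [Nonempty ι] {M : Matrix ι ι ℝ} (hM : M.PosDef) : 0 < minEigenvalue M := by
  have hne : (spectrum ℝ M).Nonempty :=
    ⟨_, hM.1.eigenvalues_mem_spectrum_real (Classical.arbitrary ι)⟩
  have := hne.csInf_mem (finite_real_spectrum (A := M))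
  rw [hM.1.spectrum_real_eq_range_eigenvalues] at this
  obtain ⟨j, hj⟩ := this
  rw [minEigenvalue, hM.1.spectrum_real_eq_range_eigenvalues, ← hj]
  exact hM.eigenvalues_pos j

/-- Crude, but enough to turn the entrywise law of large numbers into convergence in operator norm.
-/
theorem norm_toEuclideanCLM_le_sum (M : Matrix ι ι ℝ) :
    ‖toEuclideanCLM (𝕜 := ℝ) M‖ ≤ ∑ a, ∑ b, |M a b| := by
  have hM : toEuclideanCLM (𝕜 := ℝ) M =
      ∑ a, ∑ b, M a b • toEuclideanCLM (𝕜 := ℝ) (single a b (1 : ℝ)) := by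
    conv_lhs => rw [matrix_eq_sum_single M]
    simp only [map_sum]
    refine Finset.sum_congr rfl fun a _ => Finset.sum_congr rfl fun b _ => ?_
    rw [← map_smul, smul_single, smul_eq_mul, mul_one]
  rw [hM]
  refine (norm_sum_le _ _).trans (Finset.sum_le_sum fun a _ => ?_)
  refine (norm_sum_le _ _).trans (Finset.sum_le_sum fun b _ => ?_)
  rw [norm_smul, Real.norm_eq_abs]
  refine mul_le_of_le_one_right (abs_nonneg _) ?_
  refine ContinuousLinearMap.opNorm_le_bound _ zero_le_one fun x => ?_
  rw [one_mul]
  have : toEuclideanCLM (𝕜 := ℝ) (single a b (1 : ℝ)) x = EuclideanSpace.single a (x b) := by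
    apply (WithLp.ofLp_injective 2)
    rw [ofLp_toEuclideanCLM]
    ext k
    by_cases hk : k = a
    · subst hk; simp [single_mulVec]
    · simp [single_mulVec, hk]
  rw [this, EuclideanSpace.single, PiLp.norm_single]
  exact PiLp.norm_apply_le x b

theorem toEuclideanCLM_sqrt_mul_self {A : Matrix ι ι ℝ} (hA : A.PosSemidef)
    (x : EuclideanSpace ℝ ι) :
    toEuclideanCLM (𝕜 := ℝ) (CFC.sqrt A) (toEuclideanCLM (𝕜 := ℝ) (CFC.sqrt A) x) =
      toEuclideanCLM (𝕜 := ℝ) A x := by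
  conv_rhs => rw [← CFC.sqrt_mul_sqrt_self A hA.nonneg, map_mul]
  rfl

theorem norm_toEuclideanCLM_sqrt_sq {A : Matrix ι ι ℝ} (hA : A.PosSemidef)
    (x : EuclideanSpace ℝ ι) :
    ‖toEuclideanCLM (𝕜 := ℝ) (CFC.sqrt A) x‖ ^ 2 = ⟪x, toEuclideanCLM (𝕜 := ℝ) A x⟫ := by
  rw [← real_inner_self_eq_norm_sq, inner_toEuclideanCLM_comm (CFC.sqrt_nonneg A).posSemidef.1,
    toEuclideanCLM_sqrt_mul_self hA]

/-- The square root of positive semidefinite matrices is Hölder continuous with exponent `1/2`. -/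
theorem norm_sqrt_sub_sqrt_sq_le {A B : Matrix ι ι ℝ} (hA : A.PosSemidef) (hB : B.PosSemidef) :
    ‖toEuclideanCLM (𝕜 := ℝ) (CFC.sqrt A) - toEuclideanCLM (𝕜 := ℝ) (CFC.sqrt B)‖ ^ 2 ≤
      ‖toEuclideanCLM (𝕜 := ℝ) A - toEuclideanCLM (𝕜 := ℝ) B‖ := by
  have hRA := (CFC.sqrt_nonneg A).posSemidef
  have hRB := (CFC.sqrt_nonneg B).posSemidef
  have hS : (CFC.sqrt A - CFC.sqrt B).IsHermitian := hRA.1.sub hRB.1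
  suffices h : ‖toEuclideanCLM (𝕜 := ℝ) (CFC.sqrt A - CFC.sqrt B)‖ ≤
      √‖toEuclideanCLM (𝕜 := ℝ) A - toEuclideanCLM (𝕜 := ℝ) B‖ by
    rw [← map_sub]
    exact (Real.le_sqrt (norm_nonneg _) (norm_nonneg _)).1 h
  refine norm_toEuclideanCLM_le_of_eigenvalues hS (Real.sqrt_nonneg _) fun j => ?_
  refine Real.abs_le_sqrt ?_
  -- With (√A - √B) e = l e and ‖e‖ = 1, expanding ⟪e, (A - B) e⟫ = ‖√A e‖² - ‖√B e‖² gives l (⟪e,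
  -- √A e⟫ + ⟪e, √B e⟫). Both inner products are nonnegative and their difference is l, so their sum
  -- is at least |l|, whence l² ≤ ‖A - B‖.
  set e := hS.eigenvectorBasis j
  set l := hS.eigenvalues j
  have he : ‖e‖ = 1 := hS.eigenvectorBasis.norm_eq_one j
  have hSe : toEuclideanCLM (𝕜 := ℝ) (CFC.sqrt A) e - toEuclideanCLM (𝕜 := ℝ) (CFC.sqrt B) e
      = l • e := by
    rw [← _root_.sub_apply, ← map_sub]
    exact toEuclideanCLM_eigenvectorBasis hS j
  have hAe := (posSemidef_iff_inner.1 hRA).2 e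
  have hBe := (posSemidef_iff_inner.1 hRB).2 e
  have hle : l = ⟪e, toEuclideanCLM (𝕜 := ℝ) (CFC.sqrt A) e⟫ -
      ⟪e, toEuclideanCLM (𝕜 := ℝ) (CFC.sqrt B) e⟫ := by
    rw [← inner_sub_right, hSe, real_inner_smul_right, real_inner_self_eq_norm_sq, he]; simp
  have key : ⟪e, (toEuclideanCLM (𝕜 := ℝ) A - toEuclideanCLM (𝕜 := ℝ) B) e⟫ =
      l * (⟪e, toEuclideanCLM (𝕜 := ℝ) (CFC.sqrt A) e⟫ +
        ⟪e, toEuclideanCLM (𝕜 := ℝ) (CFC.sqrt B) e⟫) := by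
    rw [_root_.sub_apply, inner_sub_right, ← norm_toEuclideanCLM_sqrt_sq hA,
      ← norm_toEuclideanCLM_sqrt_sq hB]
    have h1 : toEuclideanCLM (𝕜 := ℝ) (CFC.sqrt A) e =
        toEuclideanCLM (𝕜 := ℝ) (CFC.sqrt B) e + l • e := by rw [← hSe]; abel
    rw [h1, @norm_add_sq_real, inner_add_right, real_inner_smul_right, real_inner_smul_right,
      norm_smul, he, real_inner_self_eq_norm_sq, he, real_inner_comm, Real.norm_eq_abs, mul_one,
      sq_abs]
    ring
  have hub : |⟪e, (toEuclideanCLM (𝕜 := ℝ) A - toEuclideanCLM (𝕜 := ℝ) B) e⟫| ≤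
      ‖toEuclideanCLM (𝕜 := ℝ) A - toEuclideanCLM (𝕜 := ℝ) B‖ := by
    refine (abs_real_inner_le_norm _ _).trans ?_
    have := (toEuclideanCLM (𝕜 := ℝ) A - toEuclideanCLM (𝕜 := ℝ) B).le_opNorm e
    rw [he, mul_one] at this
    rwa [he, one_mul]
  refine le_trans ?_ hub
  rw [key, abs_mul, ← sq_abs l, sq]
  refine mul_le_mul_of_nonneg_left ?_ (abs_nonneg _)
  rw [abs_of_nonneg (add_nonneg hAe hBe)]
  exact abs_le.2 ⟨by linarith, by linarith⟩

theorem continuousOn_sqrt_posSemidef :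
    ContinuousOn (fun A : Matrix ι ι ℝ => toEuclideanCLM (𝕜 := ℝ) (CFC.sqrt A))
      {A | A.PosSemidef} := by
  have hT : Continuous fun A : Matrix ι ι ℝ => toEuclideanCLM (𝕜 := ℝ) A :=
    (toEuclideanCLM (𝕜 := ℝ) (n := ι)).toAlgEquiv.toLinearMap.continuous_of_finiteDimensional
  intro A hA
  rw [ContinuousWithinAt, tendsto_iff_norm_sub_tendsto_zero]
  have h0 : Tendsto (fun B : Matrix ι ι ℝ =>
      √‖toEuclideanCLM (𝕜 := ℝ) B - toEuclideanCLM (𝕜 := ℝ) A‖) (𝓝[{A | A.PosSemidef}] A) (𝓝 0) := by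
    have : Continuous fun B : Matrix ι ι ℝ =>
      √‖toEuclideanCLM (𝕜 := ℝ) B - toEuclideanCLM (𝕜 := ℝ) A‖ := by fun_prop
    simpa using (this.tendsto A).mono_left nhdsWithin_le_nhds
  refine squeeze_zero' (Eventually.of_forall fun _ => norm_nonneg _) ?_ h0
  filter_upwards [self_mem_nhdsWithin] with B hB
  exact Real.le_sqrt_of_sq_le (norm_sqrt_sub_sqrt_sq_le hB hA)

theorem isClosed_posSemidef : IsClosed {A : Matrix ι ι ℝ | A.PosSemidef} := by
  have hT : Continuous fun A : Matrix ι ι ℝ => toEuclideanCLM (𝕜 := ℝ) A :=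
    (toEuclideanCLM (𝕜 := ℝ) (n := ι)).toAlgEquiv.toLinearMap.continuous_of_finiteDimensional
  simp only [posSemidef_iff_inner, Set.ofPred_and, Set.ofPred_forall]
  refine IsClosed.inter ?_ (isClosed_iInter fun x => ?_)
  · exact isClosed_eq (by fun_prop) continuous_id
  · exact isClosed_le continuous_const (by fun_prop)

/-- The square root is continuous on the closed cone of positive semidefinite matrices and is
constantly 0 off it, hence Borel. -/
theorem measurable_toEuclideanCLM_sqrt_apply {α : Type*} [MeasurableSpace α]
    {A : α → Matrix ι ι ℝ} (hA : ∀ i j, Measurable fun ω => A ω i j)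
    {v : α → EuclideanSpace ℝ ι} (hv : Measurable v) :
    Measurable fun ω => toEuclideanCLM (𝕜 := ℝ) (CFC.sqrt (A ω)) (v ω) := by
  classical
  let _ : MeasurableSpace (Matrix ι ι ℝ) := MeasurableSpace.pi
  have : BorelSpace (Matrix ι ι ℝ) := inferInstanceAs (BorelSpace (ι → ι → ℝ))
  let _ : MeasurableSpace (EuclideanSpace ℝ ι →L[ℝ] EuclideanSpace ℝ ι) := borel _
  have : BorelSpace (EuclideanSpace ℝ ι →L[ℝ] EuclideanSpace ℝ ι) := ⟨rfl⟩
  have hAm : Measurable A := measurable_pi_lambda _ fun i => measurable_pi_lambda _ fun j => hA i j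
  have hs : MeasurableSet {A : Matrix ι ι ℝ | A.PosSemidef} := isClosed_posSemidef.measurableSet
  have hsqrt : Measurable fun A : Matrix ι ι ℝ => toEuclideanCLM (𝕜 := ℝ) (CFC.sqrt A) := by
    have heq : (fun A : Matrix ι ι ℝ => toEuclideanCLM (𝕜 := ℝ) (CFC.sqrt A)) =
        Set.piecewise {A | A.PosSemidef} (fun A => toEuclideanCLM (𝕜 := ℝ) (CFC.sqrt A))
          (fun _ => 0) := by
      ext1 A
      by_cases hA : A.PosSemidef
      · simp [Set.piecewise, hA]
      · have : CFC.sqrt A = 0 := CFC.sqrt_of_not_nonneg fun h => hA h.posSemidef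
        simp [Set.piecewise, hA, this]
    rw [heq]
    exact continuousOn_sqrt_posSemidef.measurable_piecewise continuousOn_const hs
  have happ : Continuous fun z : (EuclideanSpace ℝ ι →L[ℝ] EuclideanSpace ℝ ι) ×
      EuclideanSpace ℝ ι => z.1 z.2 := by fun_prop
  exact happ.measurable.comp ((hsqrt.comp hAm).prodMk hv)

end Matrices

/-! ### Comparison of √A h with (√V)⁻¹ s -/

section Matrices

open Matrix
open scoped RealInnerProductSpace

variable {ι : Type*} [Fintype ι] [DecidableEq ι]

/-- Replacing `√V` by `√A` and linearizing: if `A` is close to `V`, and `A h` is close to `s`, then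
`√A h` is close to `(√V)⁻¹ s`. -/
theorem norm_sqrt_apply_sub_le {A V : Matrix ι ι ℝ} (hA : A.PosSemidef) (hV : V.PosSemidef)
    {c C ε r : ℝ} (hc : 0 < c) (hC : 0 ≤ C) (hr : 0 < r) (hε0 : 0 ≤ ε) (hε : ε ≤ c / 4)
    (hVlow : ∀ u : EuclideanSpace ℝ ι, c * r * ‖u‖ ^ 2 ≤ ⟪u, toEuclideanCLM (𝕜 := ℝ) V u⟫)
    (hAup : ‖toEuclideanCLM (𝕜 := ℝ) A‖ ≤ C * r)
    (hAV : ‖toEuclideanCLM (𝕜 := ℝ) A - toEuclideanCLM (𝕜 := ℝ) V‖ ≤ ε * r)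
    {h s z : EuclideanSpace ℝ ι} (hz : toEuclideanCLM (𝕜 := ℝ) (CFC.sqrt V) z = s)
    (hs : ‖s - toEuclideanCLM (𝕜 := ℝ) A h‖ ≤ ε * r * ‖h‖) :
    ‖toEuclideanCLM (𝕜 := ℝ) (CFC.sqrt A) h - z‖ ≤
      2 / (c * √c) * (√(ε * C) + ε) * (‖s‖ / √r) := by
  -- ⟪h, V h⟫ differs from ⟪h, s⟫ by at most 2 ε r ‖h‖² ≤ (c / 2) r ‖h‖², so half of the lower bound
  -- on V survives. This is the reason for ε ≤ c / 4.
  have hh : c * r / 2 * ‖h‖ ≤ ‖s‖ := by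
    rcases eq_or_lt_of_le (norm_nonneg h) with h0 | hpos
    · rw [← h0, mul_zero]; exact norm_nonneg _
    have e1 : ⟪h, toEuclideanCLM (𝕜 := ℝ) V h⟫ = ⟪h, s⟫ -
        ⟪h, s - toEuclideanCLM (𝕜 := ℝ) A h⟫ -
        ⟪h, (toEuclideanCLM (𝕜 := ℝ) A - toEuclideanCLM (𝕜 := ℝ) V) h⟫ := by
      simp only [_root_.sub_apply, inner_sub_right]; ring
    have b1 : ⟪h, s⟫ ≤ ‖h‖ * ‖s‖ := real_inner_le_norm _ _
    have b2 : |⟪h, s - toEuclideanCLM (𝕜 := ℝ) A h⟫| ≤ ‖h‖ * (ε * r * ‖h‖) :=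
      (abs_real_inner_le_norm _ _).trans (by gcongr)
    have b3 : |⟪h, (toEuclideanCLM (𝕜 := ℝ) A - toEuclideanCLM (𝕜 := ℝ) V) h⟫| ≤
        ‖h‖ * (ε * r * ‖h‖) := by
      refine (abs_real_inner_le_norm _ _).trans ?_
      gcongr
      exact (ContinuousLinearMap.le_opNorm _ _).trans (by gcongr)
    have b4 := hVlow h
    have b5 : ε * r * ‖h‖ ^ 2 ≤ c / 4 * r * ‖h‖ ^ 2 := by gcongr
    have := abs_le.1 b2
    have := abs_le.1 b3
    have : ‖h‖ * (c * r / 2 * ‖h‖) ≤ ‖h‖ * ‖s‖ := by nlinarith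
    exact le_of_mul_le_mul_left this hpos
  have hsA : ‖toEuclideanCLM (𝕜 := ℝ) (CFC.sqrt A) h‖ ≤ √(C * r) * ‖h‖ := by
    rw [← sq_le_sq₀ (norm_nonneg _) (by positivity), mul_pow, Real.sq_sqrt (by positivity),
      norm_toEuclideanCLM_sqrt_sq hA]
    refine (real_inner_le_norm _ _).trans ?_
    have := (toEuclideanCLM (𝕜 := ℝ) A).le_opNorm h
    calc ‖h‖ * ‖toEuclideanCLM (𝕜 := ℝ) A h‖ ≤ ‖h‖ * (C * r * ‖h‖) := by
          gcongr; exact this.trans (by gcongr)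
      _ = _ := by ring
  have hsub : ‖toEuclideanCLM (𝕜 := ℝ) (CFC.sqrt V) - toEuclideanCLM (𝕜 := ℝ) (CFC.sqrt A)‖ ≤
      √(ε * r) := by
    refine Real.le_sqrt_of_sq_le ((norm_sqrt_sub_sqrt_sq_le hV hA).trans ?_)
    rwa [norm_sub_rev]
  set D := toEuclideanCLM (𝕜 := ℝ) (CFC.sqrt A) h - z with hD
  -- Applying √V to the difference D turns z into s. Inserting √A √A h = A h leaves one term
  -- controlled by √V - √A and one by the linearization error; coercivity of √V then recovers D.
  have hVD : toEuclideanCLM (𝕜 := ℝ) (CFC.sqrt V) D =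
      (toEuclideanCLM (𝕜 := ℝ) (CFC.sqrt V) - toEuclideanCLM (𝕜 := ℝ) (CFC.sqrt A))
        (toEuclideanCLM (𝕜 := ℝ) (CFC.sqrt A) h) - (s - toEuclideanCLM (𝕜 := ℝ) A h) := by
    rw [hD, map_sub, hz, _root_.sub_apply, toEuclideanCLM_sqrt_mul_self hA]; abel
  have hVDle : ‖toEuclideanCLM (𝕜 := ℝ) (CFC.sqrt V) D‖ ≤ r * (√(ε * C) + ε) * ‖h‖ := by
    rw [hVD]
    refine (norm_sub_le _ _).trans ?_
    have h1 : ‖(toEuclideanCLM (𝕜 := ℝ) (CFC.sqrt V) - toEuclideanCLM (𝕜 := ℝ) (CFC.sqrt A))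
        (toEuclideanCLM (𝕜 := ℝ) (CFC.sqrt A) h)‖ ≤ √(ε * r) * (√(C * r) * ‖h‖) :=
      (ContinuousLinearMap.le_opNorm _ _).trans (by gcongr)
    have h2 : √(ε * r) * (√(C * r) * ‖h‖) = r * √(ε * C) * ‖h‖ := by
      rw [← mul_assoc, ← Real.sqrt_mul (by positivity),
        show ε * r * (C * r) = r ^ 2 * (ε * C) by ring, Real.sqrt_mul (by positivity),
        Real.sqrt_sq hr.le]
    linarith
  have hDle : √c * √r * ‖D‖ ≤ ‖toEuclideanCLM (𝕜 := ℝ) (CFC.sqrt V) D‖ := by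
    rw [← Real.sqrt_mul hc.le, ← sq_le_sq₀ (by positivity) (norm_nonneg _), mul_pow,
      Real.sq_sqrt (by positivity), norm_toEuclideanCLM_sqrt_sq hV]
    exact hVlow D
  have hfin : √c * √r * ‖D‖ ≤ (√(ε * C) + ε) * (2 * ‖s‖ / c) := by
    refine (hDle.trans hVDle).trans ?_
    have : r * ‖h‖ ≤ 2 * ‖s‖ / c := by rw [le_div_iff₀ hc]; linarith
    calc r * (√(ε * C) + ε) * ‖h‖ = (√(ε * C) + ε) * (r * ‖h‖) := by ring
      _ ≤ _ := by gcongr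
  have hsc : 0 < √c := Real.sqrt_pos.2 hc
  have hsr : 0 < √r := Real.sqrt_pos.2 hr
  calc ‖D‖ = √c * √r * ‖D‖ / (√c * √r) := by field_simp
    _ ≤ (√(ε * C) + ε) * (2 * ‖s‖ / c) / (√c * √r) := by gcongr
    _ = _ := by field_simp

end Matrices

/-! ### Sums of bounded independent random vectors -/

section Sums

open Complex (I)
open scoped RealInnerProductSpace

variable {Ω : Type*} [MeasurableSpace Ω] {P : Measure Ω} [IsProbabilityMeasure P]

/-- Factors are exchanged one at a time. In the central limit theorem, f and g are the
characteristic functions of the summands and of matching normal variables. -/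
theorem norm_prod_sub_prod_le {κ : Type*} (s : Finset κ) {f g : κ → ℂ} (hf : ∀ i ∈ s, ‖f i‖ ≤ 1)
    (hg : ∀ i ∈ s, ‖g i‖ ≤ 1) : ‖∏ i ∈ s, f i - ∏ i ∈ s, g i‖ ≤ ∑ i ∈ s, ‖f i - g i‖ := by
  classical
  induction s using Finset.induction_on with
  | empty => simp
  | insert a s ha ih =>
    rw [Finset.prod_insert ha, Finset.prod_insert ha, Finset.sum_insert ha]
    have h1 : ‖∏ i ∈ s, f i‖ ≤ 1 := by
      rw [norm_prod]
      exact Finset.prod_le_one (fun _ _ => norm_nonneg _)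
        fun i hi => hf i (Finset.mem_insert_of_mem hi)
    have ih' := ih (fun i hi => hf i (Finset.mem_insert_of_mem hi))
      fun i hi => hg i (Finset.mem_insert_of_mem hi)
    have h2 := hg a (Finset.mem_insert_self _ _)
    calc ‖f a * ∏ i ∈ s, f i - g a * ∏ i ∈ s, g i‖
        = ‖(f a - g a) * ∏ i ∈ s, f i + g a * (∏ i ∈ s, f i - ∏ i ∈ s, g i)‖ := by ring_nf
      _ ≤ ‖f a - g a‖ * ‖∏ i ∈ s, f i‖ + ‖g a‖ * ‖∏ i ∈ s, f i - ∏ i ∈ s, g i‖ := by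
          refine (norm_add_le _ _).trans ?_
          rw [norm_mul, norm_mul]
      _ ≤ ‖f a - g a‖ * 1 + 1 * ∑ i ∈ s, ‖f i - g i‖ := by gcongr
      _ = _ := by ring

/-- The characteristic function of a small centered variable is that of a normal variable with the
same variance, up to a third-order error. -/
theorem norm_integral_exp_sub_exp_le {X : Ω → ℝ} (hX : Measurable X) {b : ℝ} (hb : b ≤ 1)
    (hXb : ∀ᵐ ω ∂P, |X ω| ≤ b) (h0 : ∫ ω, X ω ∂P = 0) :
    ‖∫ ω, Complex.exp (X ω * I) ∂P - Complex.exp (-((∫ ω, X ω ^ 2 ∂P : ℝ) : ℂ) / 2)‖ ≤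
      4 * b ^ 3 := by
  have hb0 : 0 ≤ b := by
    obtain ⟨ω, hω⟩ := hXb.exists
    exact (abs_nonneg _).trans hω
  have hint : Integrable X P := .of_bound hX.aestronglyMeasurable b hXb
  have hX2 : ∀ᵐ ω ∂P, X ω ^ 2 ≤ b ^ 2 := by
    filter_upwards [hXb] with ω hω
    rw [← sq_abs]; gcongr
  have hint2 : Integrable (fun ω => X ω ^ 2) P :=
    .of_bound (hX.pow_const 2).aestronglyMeasurable (b ^ 2) (by
      filter_upwards [hX2] with ω hω
      rwa [Real.norm_of_nonneg (sq_nonneg _)])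
  have hintexp : Integrable (fun ω => Complex.exp (X ω * I)) P :=
    .of_bound (by fun_prop) 1 (by
      filter_upwards with ω
      rw [Complex.norm_exp_ofReal_mul_I])
  set v := ∫ ω, X ω ^ 2 ∂P with hv
  have hv0 : 0 ≤ v := integral_nonneg fun _ => sq_nonneg _
  have hvb : v ≤ b ^ 2 := by
    simpa using integral_mono_ae hint2 (integrable_const (b ^ 2)) hX2
  have hpoly : Integrable (fun ω => (1 : ℂ) + X ω * I - ((X ω ^ 2 : ℝ) : ℂ) / 2) P :=
    ((integrable_const _).add (hint.ofReal.mul_const I)).sub (hint2.ofReal.div_const 2)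
  have hpolyint : ∫ ω, ((1 : ℂ) + X ω * I - ((X ω ^ 2 : ℝ) : ℂ) / 2) ∂P = 1 - (v : ℂ) / 2 := by
    have h1 : Integrable (fun ω => (1 : ℂ) + X ω * I) P :=
      (integrable_const _).add (hint.ofReal.mul_const I)
    have h2 : Integrable (fun ω => (X ω * I : ℂ)) P := hint.ofReal.mul_const I
    have h3 : Integrable (fun ω => ((X ω ^ 2 : ℝ) : ℂ) / 2) P := hint2.ofReal.div_const 2
    rw [integral_sub h1 h3, integral_add (integrable_const _) h2,
      integral_mul_const, integral_div, integral_complex_ofReal, integral_complex_ofReal, h0, ← hv]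
    simp
  -- Second-order Taylor expansion: the remainder is at most b³ exp b, and exp b ≤ e < 3 because b ≤
  -- 1.
  have hA : ‖∫ ω, Complex.exp (X ω * I) ∂P - (1 - (v : ℂ) / 2)‖ ≤ 3 * b ^ 3 := by
    rw [← hpolyint, ← integral_sub hintexp hpoly]
    have hbound : ∀ᵐ ω ∂P, ‖Complex.exp (X ω * I) -
        ((1 : ℂ) + X ω * I - ((X ω ^ 2 : ℝ) : ℂ) / 2)‖ ≤ 3 * b ^ 3 := by
      filter_upwards [hXb] with ω hω
      have h := Complex.norm_exp_sub_sum_le_norm_mul_exp (X ω * I) 3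
      have hs : ∑ m ∈ Finset.range 3, (X ω * I : ℂ) ^ m / (m.factorial : ℂ) =
          (1 : ℂ) + X ω * I - ((X ω ^ 2 : ℝ) : ℂ) / 2 := by
        simp [Finset.sum_range_succ, mul_pow, Nat.factorial]
        ring
      rw [hs] at h
      have hn : ‖(X ω * I : ℂ)‖ ≤ b := by simpa using hω
      have he : Real.exp ‖(X ω * I : ℂ)‖ ≤ 3 :=
        (Real.exp_le_exp.2 (hn.trans hb)).trans Real.exp_one_lt_three.le
      calc _ ≤ _ := h
        _ ≤ b ^ 3 * 3 := by gcongr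
        _ = _ := by ring
    simpa using norm_integral_le_of_norm_le_const hbound
  -- Since v ≤ b² ≤ 1, the error is at most v² / 4 ≤ b⁴ ≤ b³. Together with the previous 3 b³ this
  -- makes the constant 4.
  have hB : ‖(1 - (v : ℂ) / 2) - Complex.exp (-(v : ℂ) / 2)‖ ≤ b ^ 3 := by
    have h1 : (1 - (v : ℂ) / 2) - Complex.exp (-(v : ℂ) / 2) =
        ((-(Real.exp (-v / 2) - 1 - (-v / 2)) : ℝ) : ℂ) := by
      push_cast; ring
    rw [h1, Complex.norm_real, norm_neg, Real.norm_eq_abs]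
    have hb2 : b ^ 2 ≤ 1 := pow_le_one₀ hb0 hb
    have h2 := Real.abs_exp_sub_one_sub_id_le (x := -v / 2) (by
      rw [abs_le]; constructor <;> linarith)
    refine h2.trans ?_
    have h3 : v ^ 2 ≤ (b ^ 2) ^ 2 := by gcongr
    have h4 : b ^ 4 ≤ b ^ 3 := pow_le_pow_of_le_one hb0 hb (by norm_num)
    have h5 : 0 ≤ b ^ 3 := by positivity
    nlinarith
  calc _ = ‖(∫ ω, Complex.exp (X ω * I) ∂P - (1 - (v : ℂ) / 2)) +
      ((1 - (v : ℂ) / 2) - Complex.exp (-(v : ℂ) / 2))‖ := by rw [sub_add_sub_cancel]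
    _ ≤ _ := (norm_add_le _ _).trans (by linarith)

/-! ### Limit theorems for sums of bounded independent variables and vectors -/

variable {E : Type*} [NormedAddCommGroup E] [InnerProductSpace ℝ E] [FiniteDimensional ℝ E]
  [MeasurableSpace E] [BorelSpace E]

/-- The central limit theorem for bounded independent centered random vectors `ξ i`, normalized
by self-adjoint operators `A n` with `A n * Var (∑ ξ i) * A n = 1`. -/
theorem tendstoInDistribution_apply_sum {ξ : ℕ → Ω → E} (hm : ∀ i, Measurable (ξ i))
    (hind : iIndepFun ξ P) {K : ℝ} (hK : ∀ i, ∀ᵐ ω ∂P, ‖ξ i ω‖ ≤ K)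
    (hmean : ∀ i u, ∫ ω, ⟪ξ i ω, u⟫ ∂P = 0) {A : ℕ → E →L[ℝ] E}
    (hsymm : ∀ n x y, ⟪A n x, y⟫ = ⟪x, A n y⟫) {c : ℝ} (hc : 0 < c)
    (hA : ∀ᶠ n : ℕ in atTop, ∀ u, c * n * ‖A n u‖ ^ 2 ≤ ‖u‖ ^ 2)
    (hvar : ∀ᶠ n in atTop, ∀ u, ∑ i ∈ Finset.range n, ∫ ω, ⟪ξ i ω, A n u⟫ ^ 2 ∂P = ‖u‖ ^ 2) :
    TendstoInDistribution (fun n ω => A n (∑ i ∈ Finset.range n, ξ i ω)) atTop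
      (fun z : E => z) (fun _ => P) (stdGaussian E) where
  forall_aemeasurable n := by fun_prop
  aemeasurable_limit := by fun_prop
  tendsto := by
    have hK0 : 0 ≤ K := by
      obtain ⟨ω, hω⟩ := (hK 0).exists
      exact (norm_nonneg _).trans hω
    refine ProbabilityMeasure.tendsto_iff_tendsto_charFun.2 fun t => ?_
    simp only [ProbabilityMeasure.coe_mk, Measure.map_id', charFun_stdGaussian]
    rw [tendsto_iff_norm_sub_tendsto_zero]
    -- g n bounds every |⟪ξ i, A n t⟫|, as `hA` gives ‖A n t‖ ≤ ‖t‖ / √(c n). The total error n · 4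
    -- (g n)³ is then of order n^(-1/2).
    set g : ℕ → ℝ := fun n => K * (‖t‖ / √(c * n)) with hg
    have hsqrt : Tendsto (fun n : ℕ => √(c * n)) atTop atTop :=
      Real.tendsto_sqrt_atTop.comp (tendsto_natCast_atTop_atTop.const_mul_atTop hc)
    have hg0 : Tendsto g atTop (𝓝 0) := by
      simpa only [mul_zero] using (hsqrt.const_div_atTop ‖t‖).const_mul K
    have hlim : Tendsto (fun n : ℕ => n * (4 * g n ^ 3)) atTop (𝓝 0) := by
      have h1 : Tendsto (fun n : ℕ => 4 * (K * ‖t‖) ^ 3 / c * (1 / √(c * n))) atTop (𝓝 0) := by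
        simpa only [mul_zero] using (hsqrt.const_div_atTop 1).const_mul (4 * (K * ‖t‖) ^ 3 / c)
      refine h1.congr' ?_
      filter_upwards [eventually_gt_atTop 0] with n hn
      have hn' : (0 : ℝ) < n := by exact_mod_cast hn
      have hs : 0 < √(c * n) := Real.sqrt_pos.2 (by positivity)
      have hs2 : √(c * n) ^ 2 = c * n := Real.sq_sqrt (by positivity)
      simp only [hg]
      have hs3 : √(c * n) ^ 3 = c * n * √(c * n) := by rw [pow_succ, hs2]
      rw [mul_pow K (‖t‖ / _), div_pow, hs3]
      field_simp
    refine squeeze_zero' (Eventually.of_forall fun _ => norm_nonneg _) ?_ hlim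
    filter_upwards [hA, hvar, hg0.eventually_le_const one_pos, eventually_gt_atTop 0]
      with n hAn hvn hgn hn
    have hn' : (0 : ℝ) < n := by exact_mod_cast hn
    have hAt : K * ‖A n t‖ ≤ g n := by
      simp only [hg]
      gcongr
      rw [le_div_iff₀ (Real.sqrt_pos.2 (by positivity)),
        ← sq_le_sq₀ (by positivity) (by positivity), mul_pow, Real.sq_sqrt (by positivity)]
      linarith [hAn t]
    have hprod : charFun (P.map fun ω => A n (∑ i ∈ Finset.range n, ξ i ω)) t =
        ∏ i ∈ Finset.range n, ∫ ω, Complex.exp (((⟪ξ i ω, A n t⟫ : ℝ) : ℂ) * I) ∂P := by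
      have h1 : charFun (P.map fun ω => A n (∑ i ∈ Finset.range n, ξ i ω)) t =
          charFun (P.map fun ω => ∑ i ∈ Finset.range n, ξ i ω) (A n t) := by
        rw [charFun_apply, charFun_apply, integral_map (by fun_prop)
          (Measurable.aestronglyMeasurable (by fun_prop)), integral_map (by fun_prop)
          (Measurable.aestronglyMeasurable (by fun_prop))]
        simp only [hsymm]
      rw [h1, (hind.restrict (Finset.range n)).charFun_map_fun_finsetSum_eq_prod
        (fun i _ => (hm i).aemeasurable), Finset.prod_apply]
      refine Finset.prod_congr rfl fun i _ => ?_
      rw [charFun_apply, integral_map (hm i).aemeasurable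
          (Measurable.aestronglyMeasurable (by fun_prop))]
    -- The variances of the summands in direction A n t add up to ‖t‖², so the Gaussian
    -- characteristic function splits into factors matching the summands.
    have hexp : Complex.exp (-(‖t‖ : ℂ) ^ 2 / 2) = ∏ i ∈ Finset.range n,
        Complex.exp (-((∫ ω, ⟪ξ i ω, A n t⟫ ^ 2 ∂P : ℝ) : ℂ) / 2) := by
      rw [← Complex.exp_sum, ← Finset.sum_div, Finset.sum_neg_distrib, ← Complex.ofReal_sum, hvn t]
      push_cast; rfl
    rw [hprod, hexp]
    refine (norm_prod_sub_prod_le _ (fun i _ => ?_) fun i _ => ?_).trans ?_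
    · refine (norm_integral_le_of_norm_le_const (C := 1) ?_).trans (by simp)
      filter_upwards with ω
      rw [Complex.norm_exp_ofReal_mul_I]
    · rw [show (-((∫ ω, ⟪ξ i ω, A n t⟫ ^ 2 ∂P : ℝ) : ℂ) / 2) =
        ((-(∫ ω, ⟪ξ i ω, A n t⟫ ^ 2 ∂P) / 2 : ℝ) : ℂ) by push_cast; rfl, Complex.norm_exp_ofReal]
      have : 0 ≤ ∫ ω, ⟪ξ i ω, A n t⟫ ^ 2 ∂P := integral_nonneg fun _ => sq_nonneg _
      exact Real.exp_le_one_iff.2 (by linarith)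
    · have hsum : ∀ i ∈ Finset.range n, ‖∫ ω, Complex.exp (((⟪ξ i ω, A n t⟫ : ℝ) : ℂ) * I) ∂P -
          Complex.exp (-((∫ ω, ⟪ξ i ω, A n t⟫ ^ 2 ∂P : ℝ) : ℂ) / 2)‖ ≤ 4 * g n ^ 3 := by
        intro i _
        refine norm_integral_exp_sub_exp_le (by fun_prop) hgn ?_ (hmean i _)
        filter_upwards [hK i] with ω hω
        exact ((abs_real_inner_le_norm _ _).trans (by gcongr)).trans hAt
      exact (Finset.sum_le_card_nsmul _ _ _ hsum).trans (by simp)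

theorem variance_sum_le {Z : ℕ → Ω → ℝ} (hm : ∀ i, Measurable (Z i))
    (hind : iIndepFun Z P) {K : ℝ} (hK : ∀ i, ∀ᵐ ω ∂P, |Z i ω| ≤ K) (n : ℕ) :
    Var[∑ i ∈ Finset.range n, Z i; P] ≤ n * K ^ 2 := by
  have hL2 : ∀ i, MemLp (Z i) 2 P := fun i => .of_bound (hm i).aestronglyMeasurable K (hK i)
  rw [IndepFun.variance_sum (fun i _ => hL2 i) fun i _ j _ hij => hind.indepFun hij]
  refine (Finset.sum_le_card_nsmul _ _ (K ^ 2) fun i _ => ?_).trans (by simp)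
  refine (variance_le_expectation_sq (hm i).aestronglyMeasurable).trans ?_
  have : ∀ᵐ ω ∂P, ‖(Z i ^ 2) ω‖ ≤ K ^ 2 := by
    filter_upwards [hK i] with ω hω
    rw [Pi.pow_apply, norm_pow, Real.norm_eq_abs]; gcongr
  simpa using (le_abs_self _).trans (norm_integral_le_of_norm_le_const this)

/-- The weak law of large numbers for bounded independent random variables. -/
theorem tendstoInMeasure_sum_sub_integral_div {Z : ℕ → Ω → ℝ} (hm : ∀ i, Measurable (Z i))
    (hind : iIndepFun Z P) {K : ℝ} (hK : ∀ i, ∀ᵐ ω ∂P, |Z i ω| ≤ K) :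
    TendstoInMeasure P (fun (n : ℕ) ω =>
      (∑ i ∈ Finset.range n, Z i ω - ∑ i ∈ Finset.range n, ∫ ω, Z i ω ∂P) / n) atTop 0 := by
  have hL2 : ∀ i, MemLp (Z i) 2 P := fun i => .of_bound (hm i).aestronglyMeasurable K (hK i)
  rw [tendstoInMeasure_iff_norm]
  intro ε hε
  have hlim : Tendsto (fun n : ℕ => ENNReal.ofReal (K ^ 2 / ε ^ 2 * (1 / n))) atTop (𝓝 0) := by
    have := (tendsto_one_div_atTop_nhds_zero_nat (𝕜 := ℝ)).const_mul (K ^ 2 / ε ^ 2)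
    rw [mul_zero] at this
    simpa using ENNReal.tendsto_ofReal this
  refine tendsto_of_tendsto_of_tendsto_of_le_of_le' tendsto_const_nhds hlim
    (Eventually.of_forall fun _ => zero_le) ?_
  filter_upwards [eventually_gt_atTop 0] with n hn
  have hn' : (0 : ℝ) < n := by exact_mod_cast hn
  have hS : MemLp (∑ i ∈ Finset.range n, Z i) 2 P := memLp_finsetSum' _ fun i _ => hL2 i
  have hexp : ∫ ω, (∑ i ∈ Finset.range n, Z i) ω ∂P = ∑ i ∈ Finset.range n, ∫ ω, Z i ω ∂P := by
    simp only [Finset.sum_apply]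
    exact integral_finsetSum _ fun i _ => (hL2 i).integrable (by norm_num)
  have hcheb := meas_ge_le_variance_div_sq hS (c := ε * n) (by positivity)
  refine (measure_mono ?_).trans (hcheb.trans (ENNReal.ofReal_le_ofReal ?_))
  · intro ω hω
    simp only [Set.mem_ofPred_eq, Pi.zero_apply, sub_zero, norm_div, Real.norm_eq_abs,
      Nat.abs_cast] at hω ⊢
    rw [le_div_iff₀ hn'] at hω
    rw [hexp]
    simpa using hω
  · rw [div_le_iff₀ (by positivity)]
    refine (variance_sum_le hm hind hK n).trans (le_of_eq ?_)
    field_simp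

/-- Sums of bounded independent centered random vectors are bounded in probability at the rate
`√n`. -/
theorem measure_norm_sum_ge_le {ι : Type*} [Fintype ι] {ξ : ℕ → Ω → EuclideanSpace ℝ ι}
    (hm : ∀ i, Measurable (ξ i))
    (hind : iIndepFun ξ P) {K : ℝ} (hK : ∀ i, ∀ᵐ ω ∂P, ‖ξ i ω‖ ≤ K)
    (hmean : ∀ i u, ∫ ω, ⟪ξ i ω, u⟫ ∂P = 0) {n : ℕ} (hn : 0 < n) {M : ℝ} (hM : 0 < M) :
    P {ω | M ≤ ‖∑ i ∈ Finset.range n, ξ i ω‖ / √n} ≤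
      ENNReal.ofReal (Fintype.card ι * K ^ 2 / M ^ 2) := by
  classical
  have hn' : (0 : ℝ) < n := by exact_mod_cast hn
  set e : ι → EuclideanSpace ℝ ι := fun a => EuclideanSpace.basisFun ι ℝ a
  set S : Ω → EuclideanSpace ℝ ι := fun ω => ∑ i ∈ Finset.range n, ξ i ω with hS
  set Z : ι → ℕ → Ω → ℝ := fun a i ω => ⟪ξ i ω, e a⟫ with hZ
  have hZm : ∀ a i, Measurable (Z a i) := fun a i => by fun_prop
  have hZind : ∀ a, iIndepFun (Z a) P := fun a =>
    hind.comp (fun _ x => ⟪x, e a⟫) fun _ => by fun_prop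
  have hZK : ∀ a i, ∀ᵐ ω ∂P, |Z a i ω| ≤ K := fun a i => by
    filter_upwards [hK i] with ω hω
    refine (abs_real_inner_le_norm _ _).trans ?_
    simpa [e] using hω
  have hSZ : ∀ a ω, ⟪S ω, e a⟫ = (∑ i ∈ Finset.range n, Z a i) ω := fun a ω => by
    simp [hS, hZ, sum_inner]
  have hL2 : ∀ a, MemLp (∑ i ∈ Finset.range n, Z a i) 2 P := fun a =>
    memLp_finsetSum' _ fun i _ => .of_bound (hZm a i).aestronglyMeasurable K (hZK a i)
  have hmean0 : ∀ a, ∫ ω, (∑ i ∈ Finset.range n, Z a i) ω ∂P = 0 := fun a => by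
    simp only [Finset.sum_apply]
    rw [integral_finsetSum _ fun i _ => .of_bound (hZm a i).aestronglyMeasurable K (hZK a i)]
    exact Finset.sum_eq_zero fun i _ => hmean i (e a)
  have hsq : ∀ a, ∫ ω, ⟪S ω, e a⟫ ^ 2 ∂P ≤ n * K ^ 2 := fun a => by
    have h := variance_sum_le (hZm a) (hZind a) (hZK a) n
    rw [variance_of_integral_eq_zero (hL2 a).aestronglyMeasurable.aemeasurable (hmean0 a)] at h
    simpa only [hSZ] using h
  have hsqint : ∀ a, Integrable (fun ω => ⟪S ω, e a⟫ ^ 2) P := fun a => by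
    simpa only [hSZ] using (hL2 a).integrable_sq
  have hnorm : ∀ ω, ‖S ω‖ ^ 2 = ∑ a, ⟪S ω, e a⟫ ^ 2 := fun ω => by
    rw [← (EuclideanSpace.basisFun ι ℝ).sum_sq_norm_inner_left]
    simp [e]
  have hint : ∫ ω, ‖S ω‖ ^ 2 ∂P ≤ Fintype.card ι * (n * K ^ 2) := by
    simp only [hnorm]
    rw [integral_finsetSum _ fun a _ => hsqint a]
    exact (Finset.sum_le_card_nsmul _ _ _ fun a _ => hsq a).trans (by simp)
  have hmarkov := mul_meas_ge_le_integral_of_nonneg (μ := P) (f := fun ω => ‖S ω‖ ^ 2)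
    (Eventually.of_forall fun _ => sq_nonneg _)
    (by simp only [hnorm]; exact integrable_finsetSum _ fun a _ => hsqint a) (M ^ 2 * n)
  have hset : {ω | M ≤ ‖S ω‖ / √n} = {ω | M ^ 2 * n ≤ ‖S ω‖ ^ 2} := by
    ext ω
    simp only [Set.mem_ofPred_eq]
    rw [le_div_iff₀ (Real.sqrt_pos.2 hn'), ← sq_le_sq₀ (by positivity) (norm_nonneg _), mul_pow,
      Real.sq_sqrt hn'.le]
  rw [hset, ← ENNReal.ofReal_toReal (measure_ne_top P _)]
  refine ENNReal.ofReal_le_ofReal ?_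
  rw [le_div_iff₀ (by positivity)]
  have h := hmarkov.trans hint
  rw [measureReal_def] at h
  have : n * ((P {ω | M ^ 2 * n ≤ ‖S ω‖ ^ 2}).toReal * M ^ 2) ≤
      n * (Fintype.card ι * K ^ 2) := by linarith
  exact le_of_mul_le_mul_left this hn'

end Sums

/-! ### The standard normal distribution function -/

/-- The density of the standard normal distribution. -/
def stdNormalPDF (t : ℝ) : ℝ := gaussianPDFReal 0 1 t

theorem stdNormalPDF_pos (t : ℝ) : 0 < stdNormalPDF t := gaussianPDFReal_pos _ _ _ one_ne_zero

theorem hasDerivAt_stdNormalPDF (t : ℝ) : HasDerivAt stdNormalPDF (-t * stdNormalPDF t) t := by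
  have h : HasDerivAt (fun t : ℝ => (√(2 * Real.pi))⁻¹ * Real.exp (-t ^ 2 / 2))
      ((√(2 * Real.pi))⁻¹ * (Real.exp (-t ^ 2 / 2) * (-(2 * t) / 2))) t := by
    refine (HasDerivAt.exp ?_).const_mul _
    simpa using ((hasDerivAt_pow 2 t).neg).div_const 2
  have he : stdNormalPDF = fun t : ℝ => (√(2 * Real.pi))⁻¹ * Real.exp (-t ^ 2 / 2) := by
    ext t; simp [stdNormalPDF, gaussianPDFReal]
  rw [he]
  convert h using 1
  ring

theorem continuous_stdNormalPDF : Continuous stdNormalPDF :=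
  continuous_iff_continuousAt.2 fun t => (hasDerivAt_stdNormalPDF t).continuousAt

theorem hasDerivAt_stdNormalCDF (t : ℝ) : HasDerivAt stdNormalCDF (stdNormalPDF t) t := by
  have hint : Integrable stdNormalPDF := integrable_gaussianPDFReal 0 1
  have hreal : ∀ t, stdNormalCDF t = ∫ x in Set.Iic t, stdNormalPDF x := by
    intro t
    rw [stdNormalCDF, cdf_eq_real, measureReal_def, gaussianReal_apply_eq_integral 0 one_ne_zero,
      ENNReal.toReal_ofReal]
    · rfl
    · exact integral_nonneg fun x => (stdNormalPDF_pos x).le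
  have heq : stdNormalCDF = fun t => (∫ x in (0 : ℝ)..t, stdNormalPDF x) + stdNormalCDF 0 := by
    ext t
    rw [hreal t, hreal 0, ← intervalIntegral.integral_Iic_sub_Iic hint.integrableOn
      hint.integrableOn]
    ring
  rw [heq]
  exact (intervalIntegral.integral_hasDerivAt_right hint.intervalIntegrable
    (continuous_stdNormalPDF.stronglyMeasurableAtFilter _ _)
    continuous_stdNormalPDF.continuousAt).add_const _

theorem strictMono_stdNormalCDF : StrictMono stdNormalCDF :=
  strictMono_of_deriv_pos fun t => by
    rw [(hasDerivAt_stdNormalCDF t).deriv]; exact stdNormalPDF_pos t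

theorem stdNormalCDF_pos (t : ℝ) : 0 < stdNormalCDF t :=
  (cdf_nonneg _ (t - 1)).trans_lt (strictMono_stdNormalCDF (sub_one_lt t))

theorem stdNormalCDF_lt_one (t : ℝ) : stdNormalCDF t < 1 :=
  (strictMono_stdNormalCDF (lt_add_one t)).trans_le (cdf_le_one _ _)

theorem continuous_stdNormalCDF : Continuous stdNormalCDF :=
  continuous_iff_continuousAt.2 fun t => (hasDerivAt_stdNormalCDF t).continuousAt

/-! ### Derivatives of the log-likelihood of one observation

The probability of an observation is `δ + u a * v b`, where `δ` is the indicator of `y = 0`,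
`u = 1 - F` and `v` is the binomial probability with link `F`, minus `δ`. -/

/-- `zeroTail k` is the `k`-th derivative of `1 - F`, for `k ≤ 2`. -/
def zeroTail : ℕ → ℝ → ℝ
  | 0, a => 1 - stdNormalCDF a
  | 1, a => -stdNormalPDF a
  | _, a => a * stdNormalPDF a

theorem hasDerivAt_zeroTail {k : ℕ} (hk : k < 2) (a : ℝ) :
    HasDerivAt (zeroTail k) (zeroTail (k + 1) a) a := by
  interval_cases k
  · exact (hasDerivAt_stdNormalCDF a).const_sub 1
  · refine (hasDerivAt_stdNormalPDF a).neg.congr_deriv ?_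
    change -(-a * stdNormalPDF a) = a * stdNormalPDF a
    ring

theorem continuous_zeroTail (k : ℕ) : Continuous (zeroTail k) := by
  match k with
  | 0 => exact continuous_const.sub continuous_stdNormalCDF
  | 1 => exact continuous_stdNormalPDF.neg
  | _ + 2 => exact continuous_id.mul continuous_stdNormalPDF

/-- `binomShift m y k` is the `k`-th derivative of `b ↦ B(y; m, F b) - 1_{y = 0}`, for `k ≤ 2`,
where `B` is the binomial probability. -/
def binomShift (m y : ℕ) : ℕ → ℝ → ℝ
  | 0, b => (bernsteinPolynomial ℝ m y).eval (stdNormalCDF b) - if y = 0 then 1 else 0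
  | 1, b => (Polynomial.derivative (bernsteinPolynomial ℝ m y)).eval (stdNormalCDF b) *
      stdNormalPDF b
  | _, b => (Polynomial.derivative (Polynomial.derivative (bernsteinPolynomial ℝ m y))).eval
      (stdNormalCDF b) * stdNormalPDF b * stdNormalPDF b +
      (Polynomial.derivative (bernsteinPolynomial ℝ m y)).eval (stdNormalCDF b) *
        (-b * stdNormalPDF b)

theorem hasDerivAt_binomShift (m y : ℕ) {k : ℕ} (hk : k < 2) (b : ℝ) :
    HasDerivAt (binomShift m y k) (binomShift m y (k + 1) b) b := by
  interval_cases k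
  · exact (((bernsteinPolynomial ℝ m y).hasDerivAt _).comp b (hasDerivAt_stdNormalCDF b)).sub_const _
  · exact (((Polynomial.derivative (bernsteinPolynomial ℝ m y)).hasDerivAt _).comp b
      (hasDerivAt_stdNormalCDF b)).mul (hasDerivAt_stdNormalPDF b)

theorem continuous_binomShift (m y k : ℕ) : Continuous (binomShift m y k) := by
  have h1 := continuous_stdNormalCDF
  have h2 := continuous_stdNormalPDF
  match k with
  | 0 => unfold binomShift; fun_prop
  | 1 => unfold binomShift; fun_prop
  | _ + 2 => unfold binomShift; fun_prop

theorem binomShift_eq_zero {m y : ℕ} (h : m < y) (k : ℕ) (b : ℝ) : binomShift m y k b = 0 := by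
  have hQ := bernsteinPolynomial.eq_zero_of_lt ℝ h
  match k with
  | 0 => simp [binomShift, hQ, (Nat.zero_le m).trans_lt h |>.ne']
  | 1 => simp [binomShift, hQ]
  | _ + 2 => simp [binomShift, hQ]

/-- Bernstein polynomials sum to 1, so their derivatives sum to 0; for k = 0 the indicator of y = 0
removes the 1. -/
theorem sum_binomShift (m k : ℕ) (b : ℝ) :
    ∑ y ∈ Finset.range (m + 1), binomShift m y k b = 0 := by
  have h0 := bernsteinPolynomial.sum ℝ m
  have h1 : ∑ y ∈ Finset.range (m + 1), Polynomial.derivative (bernsteinPolynomial ℝ m y) = 0 := by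
    rw [← Polynomial.derivative_sum, h0, Polynomial.derivative_one]
  have h2 : ∑ y ∈ Finset.range (m + 1),
      Polynomial.derivative (Polynomial.derivative (bernsteinPolynomial ℝ m y)) = 0 := by
    rw [← Polynomial.derivative_sum, h1, Polynomial.derivative_zero]
  match k with
  | 0 => simp [binomShift, Finset.sum_sub_distrib, ← Polynomial.eval_finsetSum, h0]
  | 1 => simp [binomShift, ← Finset.sum_mul, ← Polynomial.eval_finsetSum, h1]
  | _ + 2 =>
    simp [binomShift, Finset.sum_add_distrib, ← Finset.sum_mul, ← Polynomial.eval_finsetSum, h1,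
      h2, -neg_mul, -mul_neg]

/-- The probability of the observation `y` as a function of the linear predictors. -/
def obsProb (m y : ℕ) (a b : ℝ) : ℝ := zibProb m (stdNormalCDF a) (stdNormalCDF b) y

theorem obsProb_eq (m y : ℕ) (a b : ℝ) :
    obsProb m y a b = (if y = 0 then 1 else 0) + zeroTail 0 a * binomShift m y 0 b := by
  simp only [obsProb, zibProb, zeroTail, binomShift, bernsteinPolynomial, Polynomial.eval_mul,
    Polynomial.eval_pow, Polynomial.eval_natCast, Polynomial.eval_X, Polynomial.eval_sub,
    Polynomial.eval_one]
  split_ifs <;> ring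

theorem obsProb_eq_zero {m y : ℕ} (h : m < y) (a b : ℝ) : obsProb m y a b = 0 := by
  simp [obsProb_eq, binomShift_eq_zero h, (Nat.zero_le m).trans_lt h |>.ne']

theorem obsProb_pos {m y : ℕ} (h : y ≤ m) (a b : ℝ) : 0 < obsProb m y a b := by
  have h1 := stdNormalCDF_pos b
  have h2 := sub_pos.2 (stdNormalCDF_lt_one b)
  have h3 := sub_pos.2 (stdNormalCDF_lt_one a)
  have h4 := stdNormalCDF_pos a
  have h5 : (0 : ℝ) < m.choose y := by exact_mod_cast Nat.choose_pos h
  unfold obsProb zibProb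
  split_ifs <;> positivity

theorem continuous_obsProb (m y : ℕ) : Continuous fun z : ℝ × ℝ => obsProb m y z.1 z.2 := by
  have h1 := continuous_zeroTail 0
  have h2 := continuous_binomShift m y 0
  simp only [obsProb_eq]
  fun_prop

theorem sum_obsProb (m : ℕ) (a b : ℝ) : ∑ y ∈ Finset.range (m + 1), obsProb m y a b = 1 := by
  simp [obsProb_eq, Finset.sum_add_distrib, ← Finset.mul_sum, sum_binomShift]

/-- The partial derivative of order `(k, l)` of the probability of `y`, divided by that
probability. -/
def relDeriv (m y k l : ℕ) (a b : ℝ) : ℝ := zeroTail k a * binomShift m y l b / obsProb m y a b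

/-- An impossible count y > m has probability 0, and x / 0 = 0 agrees with the derivative of the
constant log 0 = 0. The derivative formulas below thus hold for every y. -/
theorem relDeriv_eq_zero {m y : ℕ} (h : m < y) (k l : ℕ) (a b : ℝ) : relDeriv m y k l a b = 0 := by
  simp [relDeriv, obsProb_eq_zero h]

theorem continuous_relDeriv (m y k l : ℕ) :
    Continuous fun z : ℝ × ℝ => relDeriv m y k l z.1 z.2 := by
  rcases lt_or_ge m y with h | h
  · simp only [relDeriv_eq_zero h]; fun_prop
  · have h1 := continuous_zeroTail k
    have h2 := continuous_binomShift m y l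
    unfold relDeriv
    exact Continuous.div (by fun_prop) (continuous_obsProb m y) fun z => (obsProb_pos h _ _).ne'

/-- The probability cancels, and what is left sums to 0 because total mass is constant. Both the
centring of the score and the information equality come from this identity. -/
theorem sum_obsProb_mul_relDeriv (m k l : ℕ) (a b : ℝ) :
    ∑ y ∈ Finset.range (m + 1), obsProb m y a b * relDeriv m y k l a b = 0 := by
  have : ∀ y ∈ Finset.range (m + 1), obsProb m y a b * relDeriv m y k l a b =
      zeroTail k a * binomShift m y l b := fun y hy => by
    rw [relDeriv, mul_div_cancel₀ _ (obsProb_pos (Nat.lt_succ_iff.1 (Finset.mem_range.1 hy)) a b).ne']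
  rw [Finset.sum_congr rfl this, ← Finset.mul_sum, sum_binomShift, mul_zero]

/-- The second derivative `∂²/∂a²` of the log-likelihood of an observation. -/
def obsDerivAA (m y : ℕ) (a b : ℝ) : ℝ := relDeriv m y 2 0 a b - relDeriv m y 1 0 a b ^ 2

/-- The second derivative `∂²/∂a∂b` of the log-likelihood of an observation. -/
def obsDerivAB (m y : ℕ) (a b : ℝ) : ℝ :=
  relDeriv m y 1 1 a b - relDeriv m y 1 0 a b * relDeriv m y 0 1 a b

/-- The second derivative `∂²/∂b²` of the log-likelihood of an observation. -/
def obsDerivBB (m y : ℕ) (a b : ℝ) : ℝ := relDeriv m y 0 2 a b - relDeriv m y 0 1 a b ^ 2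

theorem continuous_obsDerivAA (m y : ℕ) : Continuous fun z : ℝ × ℝ => obsDerivAA m y z.1 z.2 :=
  (continuous_relDeriv m y 2 0).sub ((continuous_relDeriv m y 1 0).pow 2)

theorem continuous_obsDerivAB (m y : ℕ) : Continuous fun z : ℝ × ℝ => obsDerivAB m y z.1 z.2 :=
  (continuous_relDeriv m y 1 1).sub ((continuous_relDeriv m y 1 0).mul (continuous_relDeriv m y 0 1))

theorem continuous_obsDerivBB (m y : ℕ) : Continuous fun z : ℝ × ℝ => obsDerivBB m y z.1 z.2 :=
  (continuous_relDeriv m y 0 2).sub ((continuous_relDeriv m y 0 1).pow 2)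

/-- `ga` and `gb` are the partial derivatives of the differentiable function `g`. -/
def HasGrad (g ga gb : ℝ → ℝ → ℝ) : Prop :=
  ∀ a b, HasFDerivAt (fun z : ℝ × ℝ => g z.1 z.2)
    (ga a b • ContinuousLinearMap.fst ℝ ℝ ℝ + gb a b • ContinuousLinearMap.snd ℝ ℝ ℝ) (a, b)

theorem HasGrad.hasDerivAt_left {g ga gb : ℝ → ℝ → ℝ} (h : HasGrad g ga gb) (a b : ℝ) :
    HasDerivAt (fun t => g t b) (ga a b) a := by
  have := (h a b).comp_hasDerivAt a ((hasDerivAt_id a).prodMk (hasDerivAt_const a b))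
  simpa [Function.comp_def] using this

theorem HasGrad.hasDerivAt_right {g ga gb : ℝ → ℝ → ℝ} (h : HasGrad g ga gb) (a b : ℝ) :
    HasDerivAt (fun t => g a t) (gb a b) b := by
  have := (h a b).comp_hasDerivAt b ((hasDerivAt_const b a).prodMk (hasDerivAt_id b))
  simpa [Function.comp_def] using this

theorem HasGrad.comp {E : Type*} [NormedAddCommGroup E] [NormedSpace ℝ E] {g ga gb : ℝ → ℝ → ℝ}
    (h : HasGrad g ga gb) (α β : E →L[ℝ] ℝ) (x : E) :
    HasFDerivAt (fun x => g (α x) (β x)) (ga (α x) (β x) • α + gb (α x) (β x) • β) x := by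
  refine ((h (α x) (β x)).comp x (α.hasFDerivAt.prodMk β.hasFDerivAt)).congr_fderiv ?_
  ext v
  simp

theorem hasGrad_mul {u u' v v' : ℝ → ℝ} (hu : ∀ a, HasDerivAt u (u' a) a)
    (hv : ∀ b, HasDerivAt v (v' b) b) :
    HasGrad (fun a b => u a * v b) (fun a b => u' a * v b) (fun a b => u a * v' b) := by
  intro a b
  have h1 : HasFDerivAt (fun z : ℝ × ℝ => u z.1) (u' a • ContinuousLinearMap.fst ℝ ℝ ℝ) (a, b) :=
    (hu a).comp_hasFDerivAt (a, b) hasFDerivAt_fst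
  have h2 : HasFDerivAt (fun z : ℝ × ℝ => v z.2) (v' b • ContinuousLinearMap.snd ℝ ℝ ℝ) (a, b) :=
    (hv b).comp_hasFDerivAt (a, b) hasFDerivAt_snd
  refine (h1.mul h2).congr_fderiv ?_
  ext <;> simp [mul_comm]

/-- The quotient rule is arranged so that, for g = `obsProb`, each quotient is again a `relDeriv`.
-/
theorem HasGrad.div {f fa fb g ga gb : ℝ → ℝ → ℝ} (hf : HasGrad f fa fb) (hg : HasGrad g ga gb)
    (h0 : ∀ a b, g a b ≠ 0) :
    HasGrad (fun a b => f a b / g a b)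
      (fun a b => fa a b / g a b - f a b / g a b * (ga a b / g a b))
      (fun a b => fb a b / g a b - f a b / g a b * (gb a b / g a b)) := by
  intro a b
  have hinv : HasFDerivAt (fun z : ℝ × ℝ => (g z.1 z.2)⁻¹)
      (-(g a b ^ 2)⁻¹ • (ga a b • ContinuousLinearMap.fst ℝ ℝ ℝ +
        gb a b • ContinuousLinearMap.snd ℝ ℝ ℝ)) (a, b) :=
    (hasDerivAt_inv (h0 a b)).comp_hasFDerivAt (a, b) (hg a b)
  simp only [div_eq_mul_inv]
  refine ((hf a b).mul hinv).congr_fderiv ?_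
  ext <;> simp <;> ring

theorem hasGrad_obsProb (m y : ℕ) : HasGrad (obsProb m y)
    (fun a b => zeroTail 1 a * binomShift m y 0 b)
    (fun a b => zeroTail 0 a * binomShift m y 1 b) := by
  intro a b
  have h := hasGrad_mul (fun a => hasDerivAt_zeroTail (k := 0) two_pos a)
    (fun b => hasDerivAt_binomShift m y (k := 0) two_pos b) a b
  simp only [obsProb_eq]
  exact h.const_add _

theorem hasGrad_obsLogLik (m y : ℕ) :
    HasGrad (obsLogLik m y) (relDeriv m y 1 0) (relDeriv m y 0 1) := by
  intro a b
  change HasFDerivAt (fun z : ℝ × ℝ => Real.log (obsProb m y z.1 z.2)) _ _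
  rcases lt_or_ge m y with h | h
  · simp only [relDeriv_eq_zero h, obsProb_eq_zero h, Real.log_zero, zero_smul, add_zero]
    exact hasFDerivAt_const _ _
  · have := (Real.hasDerivAt_log (obsProb_pos h a b).ne').comp_hasFDerivAt (a, b)
      (hasGrad_obsProb m y a b)
    refine this.congr_fderiv ?_
    simp only [relDeriv, smul_add, smul_smul]
    congr 2 <;> ring

theorem hasGrad_relDeriv_one_zero (m y : ℕ) :
    HasGrad (relDeriv m y 1 0) (obsDerivAA m y) (obsDerivAB m y) := by
  rcases lt_or_ge m y with h | h
  · intro a b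
    simp only [obsDerivAA, obsDerivAB, relDeriv_eq_zero h]
    simpa using hasFDerivAt_const (0 : ℝ) (a, b)
  · intro a b
    have := (hasGrad_mul (fun a => hasDerivAt_zeroTail (k := 1) one_lt_two a)
      (fun b => hasDerivAt_binomShift m y (k := 0) two_pos b)).div (hasGrad_obsProb m y)
      (fun a b => (obsProb_pos h a b).ne') a b
    refine this.congr_fderiv ?_
    congr 2
    · simp only [obsDerivAA, relDeriv]; ring

theorem hasGrad_relDeriv_zero_one (m y : ℕ) :
    HasGrad (relDeriv m y 0 1) (obsDerivAB m y) (obsDerivBB m y) := by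
  rcases lt_or_ge m y with h | h
  · intro a b
    simp only [obsDerivAB, obsDerivBB, relDeriv_eq_zero h]
    simpa using hasFDerivAt_const (0 : ℝ) (a, b)
  · intro a b
    have := (hasGrad_mul (fun a => hasDerivAt_zeroTail (k := 0) two_pos a)
      (fun b => hasDerivAt_binomShift m y (k := 1) one_lt_two b)).div (hasGrad_obsProb m y)
      (fun a b => (obsProb_pos h a b).ne') a b
    refine this.congr_fderiv ?_
    congr 2
    · simp only [obsDerivAB, relDeriv]; ring
    · simp only [obsDerivBB, relDeriv]; ring

/-- The score of one observation has mean zero. -/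
theorem sum_obsProb_mul_score (m : ℕ) (a b α β : ℝ) :
    ∑ y ∈ Finset.range (m + 1),
      obsProb m y a b * (relDeriv m y 1 0 a b * α + relDeriv m y 0 1 a b * β) = 0 := by
  have h : ∀ y, obsProb m y a b * (relDeriv m y 1 0 a b * α + relDeriv m y 0 1 a b * β) =
      obsProb m y a b * relDeriv m y 1 0 a b * α + obsProb m y a b * relDeriv m y 0 1 a b * β :=
    fun y => by ring
  simp only [h, Finset.sum_add_distrib, ← Finset.sum_mul, sum_obsProb_mul_relDeriv]
  ring

/-- The information equality for one observation. -/
theorem sum_obsProb_mul_score_sq_add (m : ℕ) (a b α β : ℝ) :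
    ∑ y ∈ Finset.range (m + 1), obsProb m y a b *
      ((relDeriv m y 1 0 a b * α + relDeriv m y 0 1 a b * β) ^ 2 +
        (obsDerivAA m y a b * α ^ 2 + 2 * obsDerivAB m y a b * α * β + obsDerivBB m y a b * β ^ 2))
      = 0 := by
  -- The squared first-order terms of the Hessian cancel the squared score, leaving only
  -- second-order `relDeriv` terms, each of mean zero.
  have h : ∀ y, obsProb m y a b *
      ((relDeriv m y 1 0 a b * α + relDeriv m y 0 1 a b * β) ^ 2 +
        (obsDerivAA m y a b * α ^ 2 + 2 * obsDerivAB m y a b * α * β + obsDerivBB m y a b * β ^ 2)) =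
      obsProb m y a b * relDeriv m y 2 0 a b * α ^ 2 +
      obsProb m y a b * relDeriv m y 1 1 a b * (2 * α * β) +
      obsProb m y a b * relDeriv m y 0 2 a b * β ^ 2 :=
    fun y => by simp only [obsDerivAA, obsDerivAB, obsDerivBB]; ring
  simp only [h, Finset.sum_add_distrib, ← Finset.sum_mul, sum_obsProb_mul_relDeriv]
  ring

/-! ### Score and Hessian of a sample -/

section ScoreHessian

open Matrix
open scoped RealInnerProductSpace

variable {p q : ℕ}

/-- The covariates `x` of the zero-inflation component as a vector of the parameter space. -/
def embZero (x : EuclideanSpace ℝ (Fin p)) : Param p q :=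
  WithLp.toLp 2 (Sum.elim (fun j => x j) fun _ => 0)

/-- The covariates `w` of the binomial component as a vector of the parameter space. -/
def embBinom (w : EuclideanSpace ℝ (Fin q)) : Param p q :=
  WithLp.toLp 2 (Sum.elim (fun _ => 0) fun j => w j)

theorem zeroPredictor_eq_inner (θ : Param p q) (x : EuclideanSpace ℝ (Fin p)) :
    zeroPredictor θ x = ⟪embZero x, θ⟫ := by
  simp [zeroPredictor, betaPart, embZero, PiLp.inner_apply]

theorem binomPredictor_eq_inner (θ : Param p q) (w : EuclideanSpace ℝ (Fin q)) :
    binomPredictor θ w = ⟪embBinom w, θ⟫ := by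
  simp [binomPredictor, muPart, embBinom, PiLp.inner_apply]

theorem norm_embZero (x : EuclideanSpace ℝ (Fin p)) : ‖(embZero x : Param p q)‖ = ‖x‖ := by
  simp [EuclideanSpace.norm_eq, embZero]

theorem norm_embBinom (w : EuclideanSpace ℝ (Fin q)) : ‖(embBinom w : Param p q)‖ = ‖w‖ := by
  simp [EuclideanSpace.norm_eq, embBinom]

theorem abs_zeroPredictor_le (θ : Param p q) (x : EuclideanSpace ℝ (Fin p)) :
    |zeroPredictor θ x| ≤ ‖x‖ * ‖θ‖ := by
  rw [zeroPredictor_eq_inner, ← norm_embZero (q := q) x]; exact abs_real_inner_le_norm _ _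

theorem abs_binomPredictor_le (θ : Param p q) (w : EuclideanSpace ℝ (Fin q)) :
    |binomPredictor θ w| ≤ ‖w‖ * ‖θ‖ := by
  rw [binomPredictor_eq_inner, ← norm_embBinom (p := p) w]; exact abs_real_inner_le_norm _ _

/-- The contribution of one observation to the score. -/
def obsScore (m y : ℕ) (x : EuclideanSpace ℝ (Fin p)) (w : EuclideanSpace ℝ (Fin q))
    (θ : Param p q) : Param p q :=
  relDeriv m y 1 0 (zeroPredictor θ x) (binomPredictor θ w) • embZero x +
    relDeriv m y 0 1 (zeroPredictor θ x) (binomPredictor θ w) • embBinom w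

/-- The contribution of one observation to the Hessian matrix. -/
def obsHess (m y : ℕ) (x : EuclideanSpace ℝ (Fin p)) (w : EuclideanSpace ℝ (Fin q))
    (θ : Param p q) : Matrix (Fin p ⊕ Fin q) (Fin p ⊕ Fin q) ℝ :=
  fromBlocks
    (of fun j j' => obsDerivAA m y (zeroPredictor θ x) (binomPredictor θ w) * x j * x j')
    (of fun j j' => obsDerivAB m y (zeroPredictor θ x) (binomPredictor θ w) * x j * w j')
    (of fun j j' => obsDerivAB m y (zeroPredictor θ x) (binomPredictor θ w) * w j * x j')
    (of fun j j' => obsDerivBB m y (zeroPredictor θ x) (binomPredictor θ w) * w j * w j')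

theorem isHermitian_obsHess (m y : ℕ) (x : EuclideanSpace ℝ (Fin p)) (w : EuclideanSpace ℝ (Fin q))
    (θ : Param p q) : (obsHess m y x w θ).IsHermitian := by
  ext a b
  rcases a with a | a <;> rcases b with b | b <;> simp [obsHess] <;> ring

/-- In this form, operator norm estimates reduce to estimates of the three scalar second
derivatives. -/
theorem toEuclideanCLM_obsHess_apply (m y : ℕ) (x : EuclideanSpace ℝ (Fin p))
    (w : EuclideanSpace ℝ (Fin q)) (θ z : Param p q) :
    toEuclideanCLM (𝕜 := ℝ) (obsHess m y x w θ) z =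
      (obsDerivAA m y (zeroPredictor θ x) (binomPredictor θ w) * zeroPredictor z x +
        obsDerivAB m y (zeroPredictor θ x) (binomPredictor θ w) * binomPredictor z w) •
          embZero x +
      (obsDerivAB m y (zeroPredictor θ x) (binomPredictor θ w) * zeroPredictor z x +
        obsDerivBB m y (zeroPredictor θ x) (binomPredictor θ w) * binomPredictor z w) •
          embBinom w := by
  apply WithLp.ofLp_injective 2
  rw [ofLp_toEuclideanCLM]
  ext a
  rcases a with a | a
  · simp [obsHess, mulVec, dotProduct, embZero, embBinom, zeroPredictor, binomPredictor, betaPart,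
      muPart, add_mul, Finset.mul_sum, Finset.sum_mul]
    congr 1 <;> exact Finset.sum_congr rfl fun _ _ => by ring
  · simp [obsHess, mulVec, dotProduct, embZero, embBinom, zeroPredictor, binomPredictor, betaPart,
      muPart, add_mul, Finset.mul_sum, Finset.sum_mul]
    congr 1 <;> exact Finset.sum_congr rfl fun _ _ => by ring

theorem inner_toEuclideanCLM_obsHess (m y : ℕ) (x : EuclideanSpace ℝ (Fin p))
    (w : EuclideanSpace ℝ (Fin q)) (θ z : Param p q) :
    ⟪z, toEuclideanCLM (𝕜 := ℝ) (obsHess m y x w θ) z⟫ =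
      obsDerivAA m y (zeroPredictor θ x) (binomPredictor θ w) * zeroPredictor z x ^ 2 +
      2 * obsDerivAB m y (zeroPredictor θ x) (binomPredictor θ w) * zeroPredictor z x *
        binomPredictor z w +
      obsDerivBB m y (zeroPredictor θ x) (binomPredictor θ w) * binomPredictor z w ^ 2 := by
  rw [toEuclideanCLM_obsHess_apply, inner_add_right, real_inner_smul_right, real_inner_smul_right,
    real_inner_comm, ← zeroPredictor_eq_inner, real_inner_comm, ← binomPredictor_eq_inner]
  ring

theorem inner_obsScore (m y : ℕ) (x : EuclideanSpace ℝ (Fin p))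
    (w : EuclideanSpace ℝ (Fin q)) (θ z : Param p q) :
    ⟪obsScore m y x w θ, z⟫ =
      relDeriv m y 1 0 (zeroPredictor θ x) (binomPredictor θ w) * zeroPredictor z x +
      relDeriv m y 0 1 (zeroPredictor θ x) (binomPredictor θ w) * binomPredictor z w := by
  rw [obsScore, inner_add_left, real_inner_smul_left, real_inner_smul_left,
    ← zeroPredictor_eq_inner, ← binomPredictor_eq_inner]

theorem HasGrad.hasFDerivAt_predictors {g ga gb : ℝ → ℝ → ℝ} (h : HasGrad g ga gb)
    (x : EuclideanSpace ℝ (Fin p)) (w : EuclideanSpace ℝ (Fin q)) (θ : Param p q) :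
    HasFDerivAt (fun θ : Param p q => g (zeroPredictor θ x) (binomPredictor θ w))
      (ga (zeroPredictor θ x) (binomPredictor θ w) • innerSL ℝ (embZero x) +
        gb (zeroPredictor θ x) (binomPredictor θ w) • innerSL ℝ (embBinom w)) θ := by
  have := h.comp (innerSL ℝ (embZero x : Param p q)) (innerSL ℝ (embBinom w : Param p q)) θ
  simpa only [innerSL_apply_apply, ← zeroPredictor_eq_inner, ← binomPredictor_eq_inner] using this

theorem hasFDerivAt_obsLogLik (m y : ℕ) (x : EuclideanSpace ℝ (Fin p))
    (w : EuclideanSpace ℝ (Fin q)) (θ : Param p q) :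
    HasFDerivAt (fun θ : Param p q => obsLogLik m y (zeroPredictor θ x) (binomPredictor θ w))
      (innerSL ℝ (obsScore m y x w θ)) θ := by
  refine ((hasGrad_obsLogLik m y).hasFDerivAt_predictors x w θ).congr_fderiv ?_
  rw [obsScore, map_add, map_smul, map_smul]

theorem hasFDerivAt_obsScore (m y : ℕ) (x : EuclideanSpace ℝ (Fin p))
    (w : EuclideanSpace ℝ (Fin q)) (θ : Param p q) :
    HasFDerivAt (obsScore m y x w) (toEuclideanCLM (𝕜 := ℝ) (obsHess m y x w θ)) θ := by
  have h1 := ((hasGrad_relDeriv_one_zero m y).hasFDerivAt_predictors x w θ).smul_const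
    (embZero x : Param p q)
  have h2 := ((hasGrad_relDeriv_zero_one m y).hasFDerivAt_predictors x w θ).smul_const
    (embBinom w : Param p q)
  refine (h1.add h2).congr_fderiv ?_
  ext1 z
  rw [toEuclideanCLM_obsHess_apply]
  simp only [_root_.add_apply, ContinuousLinearMap.smulRight_apply, _root_.smul_apply,
    innerSL_apply_apply, ← zeroPredictor_eq_inner, ← binomPredictor_eq_inner, smul_eq_mul]

/-! ### Log-likelihood, score and information as sums over the sample -/

variable {m y : ℕ → ℕ} {x : ℕ → EuclideanSpace ℝ (Fin p)} {w : ℕ → EuclideanSpace ℝ (Fin q)}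
  {n : ℕ}

/-- The logarithm of the product splits only if no factor vanishes, hence the condition y i ≤ m i;
it holds almost surely by `IsSample.ae_le_trials`. -/
theorem logLikelihood_eq_sum (hy : ∀ i, y i ≤ m i) (θ : Param p q) :
    logLikelihood m y x w n θ = ∑ i ∈ Finset.range n,
      obsLogLik (m i) (y i) (zeroPredictor θ (x i)) (binomPredictor θ (w i)) := by
  have h : ∀ i : Fin n, modelProb (m i) θ (x i) (w i) (y i) ≠ 0 :=
    fun i => (obsProb_pos (hy i) _ _).ne'
  rw [logLikelihood, likelihood, Real.log_prod fun i _ => h i, Finset.sum_range]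
  rfl

theorem hasFDerivAt_logLikelihood (hy : ∀ i, y i ≤ m i) (θ : Param p q) :
    HasFDerivAt (logLikelihood m y x w n)
      (innerSL ℝ (∑ i ∈ Finset.range n, obsScore (m i) (y i) (x i) (w i) θ)) θ := by
  have h : logLikelihood m y x w n = fun θ => ∑ i ∈ Finset.range n,
      obsLogLik (m i) (y i) (zeroPredictor θ (x i)) (binomPredictor θ (w i)) :=
    funext fun θ => logLikelihood_eq_sum hy θ
  rw [h, map_sum]
  exact HasFDerivAt.fun_sum fun i _ => hasFDerivAt_obsLogLik _ _ _ _ _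

theorem score_eq_sum (hy : ∀ i, y i ≤ m i) (θ : Param p q) :
    score m y x w n θ = ∑ i ∈ Finset.range n, obsScore (m i) (y i) (x i) (w i) θ := by
  have h : HasGradientAt (logLikelihood m y x w n)
      (∑ i ∈ Finset.range n, obsScore (m i) (y i) (x i) (w i) θ) θ :=
    hasGradientAt_iff_hasFDerivAt.2 (hasFDerivAt_logLikelihood hy θ)
  exact h.gradient

theorem hasFDerivAt_sum_obsScore (θ : Param p q) :
    HasFDerivAt (fun θ => ∑ i ∈ Finset.range n, obsScore (m i) (y i) (x i) (w i) θ)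
      (toEuclideanCLM (𝕜 := ℝ) (∑ i ∈ Finset.range n, obsHess (m i) (y i) (x i) (w i) θ)) θ := by
  rw [map_sum]
  exact HasFDerivAt.fun_sum fun i _ => hasFDerivAt_obsScore _ _ _ _ _

theorem hessian_eq_sum (hy : ∀ i, y i ≤ m i) (θ : Param p q) :
    hessian m y x w n θ = ∑ i ∈ Finset.range n, obsHess (m i) (y i) (x i) (w i) θ := by
  have h1 : fderiv ℝ (logLikelihood m y x w n) = fun θ =>
      innerSL ℝ (∑ i ∈ Finset.range n, obsScore (m i) (y i) (x i) (w i) θ) :=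
    funext fun θ => (hasFDerivAt_logLikelihood hy θ).fderiv
  have h2 := ((innerSL ℝ (E := Param p q)).hasFDerivAt.comp θ
    (hasFDerivAt_sum_obsScore (m := m) (y := y) (x := x) (w := w) (n := n) θ)).fderiv
  have hH : (∑ i ∈ Finset.range n, obsHess (m i) (y i) (x i) (w i) θ).IsHermitian := by
    rw [IsHermitian, conjTranspose_sum]
    exact Finset.sum_congr rfl fun i _ => isHermitian_obsHess _ _ _ _ _
  ext a b
  rw [hessian, of_apply, iteratedFDeriv_two_apply, h1]
  have h3 := congrArg (fun L => L (EuclideanSpace.single a 1) (EuclideanSpace.single b 1)) h2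
  refine h3.trans ?_
  change ⟪toEuclideanCLM (𝕜 := ℝ) (∑ i ∈ Finset.range n, obsHess (m i) (y i) (x i) (w i) θ)
    (EuclideanSpace.single a 1), EuclideanSpace.single b 1⟫ = _
  rw [inner_toEuclideanCLM_comm hH, inner_toEuclideanCLM]
  simp

theorem weightMatrix_eq (θ : Param p q) :
    weightMatrix m y x w n θ = fromBlocks
      (diagonal fun i : Fin n => -obsDerivAA (m i) (y i) (zeroPredictor θ (x i))
        (binomPredictor θ (w i)))
      (diagonal fun i : Fin n => -obsDerivAB (m i) (y i) (zeroPredictor θ (x i))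
        (binomPredictor θ (w i)))
      (diagonal fun i : Fin n => -obsDerivAB (m i) (y i) (zeroPredictor θ (x i))
        (binomPredictor θ (w i)))
      (diagonal fun i : Fin n => -obsDerivBB (m i) (y i) (zeroPredictor θ (x i))
        (binomPredictor θ (w i))) := by
  have hA : ∀ m y a b, iteratedDeriv 2 (fun a => obsLogLik m y a b) a = obsDerivAA m y a b := by
    intro m y a b
    rw [iteratedDeriv_succ, iteratedDeriv_one,
      funext fun a => ((hasGrad_obsLogLik m y).hasDerivAt_left a b).deriv]
    exact ((hasGrad_relDeriv_one_zero m y).hasDerivAt_left a b).deriv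
  have hB : ∀ m y a b, iteratedDeriv 2 (fun b => obsLogLik m y a b) b = obsDerivBB m y a b := by
    intro m y a b
    rw [iteratedDeriv_succ, iteratedDeriv_one,
      funext fun b => ((hasGrad_obsLogLik m y).hasDerivAt_right a b).deriv]
    exact ((hasGrad_relDeriv_zero_one m y).hasDerivAt_right a b).deriv
  have hAB : ∀ m y a b, deriv (fun a => deriv (fun b => obsLogLik m y a b) b) a =
      obsDerivAB m y a b := by
    intro m y a b
    rw [funext fun a => ((hasGrad_obsLogLik m y).hasDerivAt_right a b).deriv]
    exact ((hasGrad_relDeriv_zero_one m y).hasDerivAt_left a b).deriv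
  simp only [weightMatrix, hA, hB, hAB]

/-- No condition y i ≤ m i is needed: the weight matrix is built from single contributions, whose
derivative formulas hold for every count. -/
theorem observedInfo_eq_neg_sum (θ : Param p q) :
    observedInfo m y x w n θ = -∑ i ∈ Finset.range n, obsHess (m i) (y i) (x i) (w i) θ := by
  rw [observedInfo, designMatrix, weightMatrix_eq, fromBlocks_transpose, fromBlocks_multiply,
    fromBlocks_multiply]
  ext a b
  rw [Matrix.neg_apply, Matrix.sum_apply, Finset.sum_range, ← Finset.sum_neg_distrib]
  rcases a with a | a <;> rcases b with b | b <;>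
  · simp [mul_apply, obsHess, diagonal_apply]
    exact Finset.sum_congr rfl fun i _ => by ring

theorem observedInfo_eq_neg_hessian (hy : ∀ i, y i ≤ m i) (θ : Param p q) :
    observedInfo m y x w n θ = -hessian m y x w n θ := by
  rw [observedInfo_eq_neg_sum, hessian_eq_sum hy]

theorem isHermitian_observedInfo (θ : Param p q) : (observedInfo m y x w n θ).IsHermitian := by
  rw [observedInfo_eq_neg_sum, IsHermitian, conjTranspose_neg, conjTranspose_sum]
  exact congrArg _ (Finset.sum_congr rfl fun i _ => isHermitian_obsHess _ _ _ _ _)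

end ScoreHessian

/-! ### Uniform bounds over bounded covariates -/

section Bounds

open Matrix
open scoped RealInnerProductSpace

/-- Only finitely many pairs y ≤ m ≤ M matter, and the sum of their |f m y| is a single continuous
function, bounded on the compact ball. -/
theorem exists_bound_of_continuous {f : ℕ → ℕ → ℝ × ℝ → ℝ} (hf : ∀ m y, Continuous (f m y))
    (h0 : ∀ m y, m < y → ∀ z, f m y z = 0) (M : ℕ) (R : ℝ) :
    ∃ K, 0 ≤ K ∧ ∀ m ≤ M, ∀ y z, ‖z‖ ≤ R → |f m y z| ≤ K := by
  have hc : Continuous fun z => ∑ m ∈ Finset.range (M + 1), ∑ y ∈ Finset.range (M + 1),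
      |f m y z| := by fun_prop
  obtain ⟨K, hK⟩ := (isCompact_closedBall (0 : ℝ × ℝ) R).bddAbove_image hc.continuousOn
  refine ⟨max K 0, le_max_right _ _, fun m hm y z hz => ?_⟩
  rcases lt_or_ge m y with hy | hy
  · rw [h0 m y hy, abs_zero]; exact le_max_right _ _
  refine le_trans ?_ ((hK ⟨z, by simpa using hz, rfl⟩).trans (le_max_left _ _))
  refine le_trans ?_ (Finset.single_le_sum (f := fun m => ∑ y ∈ Finset.range (M + 1), |f m y z|)
    (fun _ _ => Finset.sum_nonneg fun _ _ => abs_nonneg _)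
    (Finset.mem_range.2 (Nat.lt_succ_of_le hm)))
  exact Finset.single_le_sum (f := fun y => |f m y z|) (fun _ _ => abs_nonneg _)
    (Finset.mem_range.2 (Nat.lt_succ_of_le (hy.trans hm)))

/-- The finitely many relevant functions form one map into a finite product with the sup norm; its
uniform continuity on the ball gives a common δ. -/
theorem exists_modulus_of_continuous {f : ℕ → ℕ → ℝ × ℝ → ℝ} (hf : ∀ m y, Continuous (f m y))
    (h0 : ∀ m y, m < y → ∀ z, f m y z = 0) (M : ℕ) (R : ℝ) {ε : ℝ} (hε : 0 < ε) :
    ∃ δ > 0, ∀ m ≤ M, ∀ y z z', ‖z‖ ≤ R → ‖z'‖ ≤ R → dist z z' < δ →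
      |f m y z - f m y z'| ≤ ε := by
  have hc : Continuous fun z => fun m : Fin (M + 1) => fun y : Fin (M + 1) => f m y z := by
    fun_prop
  have hu := (isCompact_closedBall (0 : ℝ × ℝ) R).uniformContinuousOn_of_continuous
    hc.continuousOn
  obtain ⟨δ, hδ, h⟩ := Metric.uniformContinuousOn_iff.1 hu ε hε
  refine ⟨δ, hδ, fun m hm y z z' hz hz' hd => ?_⟩
  rcases lt_or_ge m y with hy | hy
  · simp [h0 m y hy, hε.le]
  have h1 := (h z (by simpa using hz) z' (by simpa using hz') hd).le
  have h2 := (dist_pi_le_iff hε.le).1 h1 ⟨m, Nat.lt_succ_of_le hm⟩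
  have h3 := (dist_pi_le_iff hε.le).1 h2 ⟨y, Nat.lt_succ_of_le (hy.trans hm)⟩
  rwa [Real.dist_eq] at h3

theorem obsDerivAA_eq_zero {m y : ℕ} (h : m < y) (a b : ℝ) : obsDerivAA m y a b = 0 := by
  simp [obsDerivAA, relDeriv_eq_zero h]

theorem obsDerivAB_eq_zero {m y : ℕ} (h : m < y) (a b : ℝ) : obsDerivAB m y a b = 0 := by
  simp [obsDerivAB, relDeriv_eq_zero h]

theorem obsDerivBB_eq_zero {m y : ℕ} (h : m < y) (a b : ℝ) : obsDerivBB m y a b = 0 := by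
  simp [obsDerivBB, relDeriv_eq_zero h]

variable {p q : ℕ}

theorem norm_predictors_le {r : ℝ} {x : EuclideanSpace ℝ (Fin p)} {w : EuclideanSpace ℝ (Fin q)}
    (hx : ‖x‖ ≤ r) (hw : ‖w‖ ≤ r) (θ : Param p q) :
    ‖(zeroPredictor θ x, binomPredictor θ w)‖ ≤ r * ‖θ‖ := by
  rw [Prod.norm_def, max_le_iff]
  exact ⟨(abs_zeroPredictor_le θ x).trans (by gcongr), (abs_binomPredictor_le θ w).trans (by gcongr)⟩

theorem zeroPredictor_sub (θ θ' : Param p q) (x : EuclideanSpace ℝ (Fin p)) :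
    zeroPredictor (θ - θ') x = zeroPredictor θ x - zeroPredictor θ' x := by
  simp only [zeroPredictor_eq_inner, inner_sub_right]

theorem binomPredictor_sub (θ θ' : Param p q) (w : EuclideanSpace ℝ (Fin q)) :
    binomPredictor (θ - θ') w = binomPredictor θ w - binomPredictor θ' w := by
  simp only [binomPredictor_eq_inner, inner_sub_right]

theorem norm_smul_embZero_add_smul_embBinom_le {r A B C ε : ℝ} (hA : |A| ≤ ε) (hB : |B| ≤ ε)
    (hC : |C| ≤ ε) {x : EuclideanSpace ℝ (Fin p)} {w : EuclideanSpace ℝ (Fin q)} (hx : ‖x‖ ≤ r)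
    (hw : ‖w‖ ≤ r) (z : Param p q) :
    ‖(A * zeroPredictor z x + B * binomPredictor z w) • (embZero x : Param p q) +
      (B * zeroPredictor z x + C * binomPredictor z w) • (embBinom w : Param p q)‖ ≤
      4 * ε * r ^ 2 * ‖z‖ := by
  have hr : 0 ≤ r := (norm_nonneg x).trans hx
  have hε : 0 ≤ ε := (abs_nonneg A).trans hA
  have h1 : |zeroPredictor z x| ≤ r * ‖z‖ := (abs_zeroPredictor_le z x).trans (by gcongr)
  have h2 : |binomPredictor z w| ≤ r * ‖z‖ := (abs_binomPredictor_le z w).trans (by gcongr)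
  have key : ∀ s t : ℝ, |s| ≤ ε → |t| ≤ ε →
      |s * zeroPredictor z x + t * binomPredictor z w| ≤ 2 * ε * (r * ‖z‖) := by
    intro s t hs ht
    refine (abs_add_le _ _).trans ?_
    rw [abs_mul, abs_mul]
    calc _ ≤ ε * (r * ‖z‖) + ε * (r * ‖z‖) := by gcongr
      _ = _ := by ring
  refine (norm_add_le _ _).trans ?_
  rw [norm_smul, norm_smul, norm_embZero, norm_embBinom, Real.norm_eq_abs, Real.norm_eq_abs]
  calc _ ≤ 2 * ε * (r * ‖z‖) * r + 2 * ε * (r * ‖z‖) * r := by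
        gcongr
        · exact key A B hA hB
        · exact key B C hB hC
    _ = _ := by ring

theorem exists_bound_obsScore (θ : Param p q) (M : ℕ) (r : ℝ) :
    ∃ K, 0 ≤ K ∧ ∀ m ≤ M, ∀ y, ∀ x : EuclideanSpace ℝ (Fin p), ∀ w : EuclideanSpace ℝ (Fin q),
      ‖x‖ ≤ r → ‖w‖ ≤ r → ‖obsScore m y x w θ‖ ≤ K := by
  obtain ⟨K₁, hK₁, h1⟩ := exists_bound_of_continuous (fun m y => continuous_relDeriv m y 1 0)
    (fun m y h z => relDeriv_eq_zero h _ _ _ _) M (r * ‖θ‖)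
  obtain ⟨K₂, hK₂, h2⟩ := exists_bound_of_continuous (fun m y => continuous_relDeriv m y 0 1)
    (fun m y h z => relDeriv_eq_zero h _ _ _ _) M (r * ‖θ‖)
  refine ⟨K₁ * |r| + K₂ * |r|, by positivity, fun m hm y x w hx hw => ?_⟩
  refine (norm_add_le _ _).trans ?_
  rw [norm_smul, norm_smul, norm_embZero, norm_embBinom, Real.norm_eq_abs, Real.norm_eq_abs]
  have hz := norm_predictors_le hx hw θ
  have b1 := h1 m hm y _ hz
  have b2 := h2 m hm y _ hz
  exact add_le_add (mul_le_mul b1 (hx.trans (le_abs_self r)) (norm_nonneg _) hK₁)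
    (mul_le_mul b2 (hw.trans (le_abs_self r)) (norm_nonneg _) hK₂)

theorem exists_bound_obsHess (θ : Param p q) (M : ℕ) (r : ℝ) :
    ∃ K, 0 ≤ K ∧ ∀ m ≤ M, ∀ y, ∀ x : EuclideanSpace ℝ (Fin p), ∀ w : EuclideanSpace ℝ (Fin q),
      ‖x‖ ≤ r → ‖w‖ ≤ r → ‖toEuclideanCLM (𝕜 := ℝ) (obsHess m y x w θ)‖ ≤ K := by
  obtain ⟨K₁, hK₁, h1⟩ := exists_bound_of_continuous continuous_obsDerivAA
    (fun m y h z => obsDerivAA_eq_zero h _ _) M (r * ‖θ‖)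
  obtain ⟨K₂, hK₂, h2⟩ := exists_bound_of_continuous continuous_obsDerivAB
    (fun m y h z => obsDerivAB_eq_zero h _ _) M (r * ‖θ‖)
  obtain ⟨K₃, hK₃, h3⟩ := exists_bound_of_continuous continuous_obsDerivBB
    (fun m y h z => obsDerivBB_eq_zero h _ _) M (r * ‖θ‖)
  refine ⟨4 * (K₁ + K₂ + K₃) * r ^ 2, by positivity, fun m hm y x w hx hw => ?_⟩
  refine ContinuousLinearMap.opNorm_le_bound _ (by positivity) fun z => ?_
  have hz := norm_predictors_le hx hw θ
  rw [toEuclideanCLM_obsHess_apply]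
  exact norm_smul_embZero_add_smul_embBinom_le ((h1 m hm y _ hz).trans (by linarith))
    ((h2 m hm y _ hz).trans (by linarith)) ((h3 m hm y _ hz).trans (by linarith)) hx hw z

theorem exists_modulus_obsHess (θ₀ : Param p q) (M : ℕ) (r : ℝ) {ε : ℝ} (hε : 0 < ε) :
    ∃ δ > 0, ∀ m ≤ M, ∀ y, ∀ x : EuclideanSpace ℝ (Fin p), ∀ w : EuclideanSpace ℝ (Fin q),
      ‖x‖ ≤ r → ‖w‖ ≤ r → ∀ θ : Param p q, ‖θ - θ₀‖ ≤ δ →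
        ‖toEuclideanCLM (𝕜 := ℝ) (obsHess m y x w θ) -
          toEuclideanCLM (𝕜 := ℝ) (obsHess m y x w θ₀)‖ ≤ ε := by
  set R := |r| * (‖θ₀‖ + 1) with hR
  -- Chosen so that 4 η r² ≤ ε in the final operator bound; the 1 keeps the denominator positive.
  set η := ε / (4 * r ^ 2 + 1) with hη
  have hη0 : 0 < η := by positivity
  obtain ⟨δ₁, hδ₁, h1⟩ := exists_modulus_of_continuous continuous_obsDerivAA
    (fun m y h z => obsDerivAA_eq_zero h _ _) M R hη0
  obtain ⟨δ₂, hδ₂, h2⟩ := exists_modulus_of_continuous continuous_obsDerivAB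
    (fun m y h z => obsDerivAB_eq_zero h _ _) M R hη0
  obtain ⟨δ₃, hδ₃, h3⟩ := exists_modulus_of_continuous continuous_obsDerivBB
    (fun m y h z => obsDerivBB_eq_zero h _ _) M R hη0
  set δ := min δ₁ (min δ₂ δ₃) with hδ
  have hδ0 : 0 < δ := by positivity
  -- The 1 keeps both pairs of predictors in the ball of radius R; the other bound makes the
  -- predictors at θ and θ₀ differ by less than δ.
  refine ⟨min 1 (δ / (|r| + 1)), by positivity, fun m hm y x w hx hw θ hθ => ?_⟩
  have hx' := hx.trans (le_abs_self r)
  have hw' := hw.trans (le_abs_self r)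
  have hz : ‖(zeroPredictor θ x, binomPredictor θ w)‖ ≤ R := by
    refine (norm_predictors_le hx' hw' θ).trans ?_
    have : ‖θ‖ ≤ ‖θ₀‖ + ‖θ - θ₀‖ := by simpa using norm_add_le θ₀ (θ - θ₀)
    have := hθ.trans (min_le_left _ _)
    rw [hR]; gcongr; linarith
  have hz₀ : ‖(zeroPredictor θ₀ x, binomPredictor θ₀ w)‖ ≤ R := by
    refine (norm_predictors_le hx' hw' θ₀).trans ?_
    rw [hR]; gcongr; linarith
  have hd : dist (zeroPredictor θ x, binomPredictor θ w)
      (zeroPredictor θ₀ x, binomPredictor θ₀ w) < δ := by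
    rw [dist_eq_norm, Prod.mk_sub_mk, ← zeroPredictor_sub, ← binomPredictor_sub]
    refine (norm_predictors_le hx' hw' _).trans_lt ?_
    have h := hθ.trans (min_le_right _ _)
    rw [le_div_iff₀ (by positivity)] at h
    rcases eq_or_lt_of_le (norm_nonneg (θ - θ₀)) with h0 | h0
    · rw [← h0, mul_zero]; exact hδ0
    · nlinarith [abs_nonneg r]
  have e1 := h1 m hm y _ _ hz hz₀ (hd.trans_le (min_le_left _ _))
  have e2 := h2 m hm y _ _ hz hz₀ (hd.trans_le ((min_le_right _ _).trans (min_le_left _ _)))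
  have e3 := h3 m hm y _ _ hz hz₀ (hd.trans_le ((min_le_right _ _).trans (min_le_right _ _)))
  refine ContinuousLinearMap.opNorm_le_bound _ hε.le fun z => ?_
  rw [_root_.sub_apply, toEuclideanCLM_obsHess_apply, toEuclideanCLM_obsHess_apply,
    add_sub_add_comm, ← sub_smul, ← sub_smul, add_sub_add_comm, add_sub_add_comm, ← sub_mul,
    ← sub_mul, ← sub_mul, ← sub_mul]
  refine (norm_smul_embZero_add_smul_embBinom_le e1 e2 e3 hx hw z).trans ?_
  gcongr
  rw [hη]
  have : 4 * (ε / (4 * r ^ 2 + 1)) * r ^ 2 = ε * (4 * r ^ 2 / (4 * r ^ 2 + 1)) := by ring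
  rw [this]
  refine mul_le_of_le_one_right hε.le ?_
  rw [div_le_one (by positivity)]
  linarith

/-- Uniform control of the Hessian of the sample near `θ₀`, and of the remainder of the
linearized score. -/
theorem exists_delta_linearization (θ₀ : Param p q) (M : ℕ) (r : ℝ) {ε : ℝ} (hε : 0 < ε) :
    ∃ δ > 0, ∀ (m y : ℕ → ℕ) (x : ℕ → EuclideanSpace ℝ (Fin p))
      (w : ℕ → EuclideanSpace ℝ (Fin q)), (∀ i, m i ≤ M) → (∀ i, ‖x i‖ ≤ r) → (∀ i, ‖w i‖ ≤ r) →
      ∀ (n : ℕ) (θ : Param p q), ‖θ - θ₀‖ ≤ δ →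
        ‖toEuclideanCLM (𝕜 := ℝ) (observedInfo m y x w n θ) -
          toEuclideanCLM (𝕜 := ℝ) (observedInfo m y x w n θ₀)‖ ≤ ε * n ∧
        ‖∑ i ∈ Finset.range n, obsScore (m i) (y i) (x i) (w i) θ -
          ∑ i ∈ Finset.range n, obsScore (m i) (y i) (x i) (w i) θ₀ +
          toEuclideanCLM (𝕜 := ℝ) (observedInfo m y x w n θ) (θ - θ₀)‖ ≤ ε * n * ‖θ - θ₀‖ := by
  -- Half of ε, because the mean value step compares Hessians at θ' and θ, both through θ₀.
  obtain ⟨δ, hδ, h⟩ := exists_modulus_obsHess θ₀ M r (half_pos hε)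
  refine ⟨δ, hδ, fun m y x w hm hx hw n θ hθ => ?_⟩
  have hsum : ∀ θ : Param p q, ‖θ - θ₀‖ ≤ δ →
      ‖toEuclideanCLM (𝕜 := ℝ) (∑ i ∈ Finset.range n, obsHess (m i) (y i) (x i) (w i) θ) -
        toEuclideanCLM (𝕜 := ℝ) (∑ i ∈ Finset.range n, obsHess (m i) (y i) (x i) (w i) θ₀)‖ ≤
        ε / 2 * n := by
    intro θ hθ
    rw [map_sum, map_sum, ← Finset.sum_sub_distrib]
    refine (norm_sum_le_of_le _ fun i _ => h (m i) (hm i) (y i) _ _ (hx i) (hw i) θ hθ).trans ?_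
    simp [mul_comm]
  have hn : (0 : ℝ) ≤ n := n.cast_nonneg
  refine ⟨?_, ?_⟩
  · rw [observedInfo_eq_neg_sum, observedInfo_eq_neg_sum, map_neg, map_neg, ← neg_sub', norm_neg]
    refine (hsum θ hθ).trans ?_
    nlinarith
  · rw [observedInfo_eq_neg_sum, map_neg, _root_.neg_apply, ← sub_eq_add_neg]
    -- Mean value inequality on the ball with the Hessian at the endpoint θ as reference operator,
    -- so that the linearization involves the observed information at θ itself.
    refine Convex.norm_image_sub_le_of_norm_hasFDerivWithin_le'
      (s := Metric.closedBall θ₀ δ) (fun θ' _ => (hasFDerivAt_sum_obsScore θ').hasFDerivWithinAt)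
      (fun θ' hθ' => ?_) (convex_closedBall θ₀ δ) (Metric.mem_closedBall_self hδ.le)
      (by rwa [mem_closedBall_iff_norm])
    rw [mem_closedBall_iff_norm] at hθ'
    calc _ = ‖(toEuclideanCLM (𝕜 := ℝ) (∑ i ∈ Finset.range n, obsHess (m i) (y i) (x i) (w i) θ') -
        toEuclideanCLM (𝕜 := ℝ) (∑ i ∈ Finset.range n, obsHess (m i) (y i) (x i) (w i) θ₀)) -
        (toEuclideanCLM (𝕜 := ℝ) (∑ i ∈ Finset.range n, obsHess (m i) (y i) (x i) (w i) θ) -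
        toEuclideanCLM (𝕜 := ℝ) (∑ i ∈ Finset.range n, obsHess (m i) (y i) (x i) (w i) θ₀))‖ := by
          rw [sub_sub_sub_cancel_right]
      _ ≤ ε / 2 * n + ε / 2 * n := (norm_sub_le _ _).trans (add_le_add (hsum _ hθ') (hsum _ hθ))
      _ = _ := by ring

end Bounds

/-! ### Measurability -/

section Measurability

variable {α : Type*} [MeasurableSpace α] {p q : ℕ}

theorem measurable_apply_of_continuous {f : ℕ → ℝ × ℝ → ℝ} (hf : ∀ y, Continuous (f y))
    {Y : α → ℕ} (hY : Measurable Y) {Z : α → ℝ × ℝ} (hZ : Measurable Z) :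
    Measurable fun ω => f (Y ω) (Z ω) := by
  have h : Measurable fun z : ℕ × (ℝ × ℝ) => f z.1 z.2 :=
    measurable_from_prod_countable_right fun y => (hf y).measurable
  exact h.comp (hY.prodMk hZ)

theorem measurable_predictors {θ : α → Param p q} (hθ : Measurable θ)
    {x : α → EuclideanSpace ℝ (Fin p)} (hx : Measurable x)
    {w : α → EuclideanSpace ℝ (Fin q)} (hw : Measurable w) :
    Measurable fun ω => (zeroPredictor (θ ω) (x ω), binomPredictor (θ ω) (w ω)) := by
  simp only [zeroPredictor, binomPredictor, betaPart, muPart]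
  refine Measurable.prodMk ?_ ?_
  · exact Finset.measurable_fun_sum _ fun j _ => by fun_prop
  · exact Finset.measurable_fun_sum _ fun j _ => by fun_prop

theorem measurable_obsHess (m : ℕ) {Y : α → ℕ} (hY : Measurable Y) {θ : α → Param p q}
    (hθ : Measurable θ) {x : α → EuclideanSpace ℝ (Fin p)} (hx : Measurable x)
    {w : α → EuclideanSpace ℝ (Fin q)} (hw : Measurable w) (a b : Fin p ⊕ Fin q) :
    Measurable fun ω => obsHess m (Y ω) (x ω) (w ω) (θ ω) a b := by
  have hz := measurable_predictors hθ hx hw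
  have h1 := measurable_apply_of_continuous (fun y => continuous_obsDerivAA m y) hY hz
  have h2 := measurable_apply_of_continuous (fun y => continuous_obsDerivAB m y) hY hz
  have h3 := measurable_apply_of_continuous (fun y => continuous_obsDerivBB m y) hY hz
  simp only at h1 h2 h3
  rcases a with a | a <;> rcases b with b | b <;>
    simp only [obsHess, Matrix.fromBlocks_apply₁₁, Matrix.fromBlocks_apply₁₂,
      Matrix.fromBlocks_apply₂₁, Matrix.fromBlocks_apply₂₂, Matrix.of_apply] <;>
    fun_prop

theorem measurable_obsScore (m : ℕ) {Y : α → ℕ} (hY : Measurable Y) {θ : α → Param p q}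
    (hθ : Measurable θ) {x : α → EuclideanSpace ℝ (Fin p)} (hx : Measurable x)
    {w : α → EuclideanSpace ℝ (Fin q)} (hw : Measurable w) :
    Measurable fun ω => obsScore m (Y ω) (x ω) (w ω) (θ ω) := by
  have hz := measurable_predictors hθ hx hw
  have h1 := measurable_apply_of_continuous (fun y => continuous_relDeriv m y 1 0) hY hz
  have h2 := measurable_apply_of_continuous (fun y => continuous_relDeriv m y 0 1) hY hz
  have h3 : Measurable fun ω => (embZero (x ω) : Param p q) := by
    refine (WithLp.measurable_toLp 2 _).comp (measurable_pi_lambda _ ?_)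
    rintro (j | j)
    · exact (by fun_prop : Measurable fun ω => x ω j)
    · exact measurable_const
  have h4 : Measurable fun ω => (embBinom (w ω) : Param p q) := by
    refine (WithLp.measurable_toLp 2 _).comp (measurable_pi_lambda _ ?_)
    rintro (j | j)
    · exact measurable_const
    · exact (by fun_prop : Measurable fun ω => w ω j)
  exact (h1.smul h3).add (h2.smul h4)

end Measurability

/-! ### Moments of the score -/

section Moments

open Matrix
open scoped RealInnerProductSpace

variable {Ω : Type*} [MeasurableSpace Ω] {P : Measure Ω} {p q : ℕ}
  [NeZero p] [NeZero q] {m : ℕ → ℕ} {Y : ℕ → Ω → ℕ} {X : ℕ → Ω → EuclideanSpace ℝ (Fin p)}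
  {W : ℕ → Ω → EuclideanSpace ℝ (Fin q)} {θ₀ : Param p q}

theorem exists_norm_covariates_le (hX : RegularCovariates P X) (hW : RegularCovariates P W) :
    ∃ r : ℝ, ∀ᵐ ω ∂P, ∀ i, ‖X i ω‖ ≤ r ∧ ‖W i ω‖ ≤ r := by
  obtain ⟨G, hG, hXG⟩ := hX.bounded
  obtain ⟨H, hH, hWH⟩ := hW.bounded
  obtain ⟨r₁, hr₁⟩ := hG.isBounded.exists_norm_le
  obtain ⟨r₂, hr₂⟩ := hH.isBounded.exists_norm_le
  refine ⟨max r₁ r₂, ae_all_iff.2 fun i => ?_⟩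
  filter_upwards [hXG i, hWH i] with ω h1 h2
  exact ⟨(hr₁ _ h1).trans (le_max_left _ _), (hr₂ _ h2).trans (le_max_right _ _)⟩

variable [IsProbabilityMeasure P]

/-- The factor depending on the covariates is pulled out of the conditional expectation of the
indicator. The model's conditional law enters the proof only here. -/
theorem IsSample.integral_indicator_mul (h : IsSample P m Y X W θ₀) (i y : ℕ)
    {g : EuclideanSpace ℝ (Fin p) × EuclideanSpace ℝ (Fin q) → ℝ} (hg : Measurable g) {C : ℝ}
    (hC : ∀ᵐ ω ∂P, |g (X i ω, W i ω)| ≤ C) :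
    ∫ ω, (Y i ⁻¹' {y}).indicator (fun _ => (1 : ℝ)) ω * g (X i ω, W i ω) ∂P =
      ∫ ω, obsProb (m i) y (zeroPredictor θ₀ (X i ω)) (binomPredictor θ₀ (W i ω)) *
        g (X i ω, W i ω) ∂P := by
  have hXW : Measurable fun ω => (X i ω, W i ω) := (h.measurable_X i).prodMk (h.measurable_W i)
  have hle : MeasurableSpace.comap (fun ω => (X i ω, W i ω)) inferInstance ≤
    (inferInstance : MeasurableSpace Ω) := hXW.comap_le
  have hs : MeasurableSet (Y i ⁻¹' {y}) := h.measurable_Y i (measurableSet_singleton y)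
  have hind : Integrable ((Y i ⁻¹' {y}).indicator (fun _ => (1 : ℝ))) P :=
    (integrable_const _).indicator hs
  have hgm : StronglyMeasurable[MeasurableSpace.comap (fun ω => (X i ω, W i ω)) inferInstance]
      fun ω => g (X i ω, W i ω) :=
    (hg.comp (comap_measurable _)).stronglyMeasurable
  have hgint : Integrable ((Y i ⁻¹' {y}).indicator (fun _ => (1 : ℝ)) *
      fun ω => g (X i ω, W i ω)) P := by
    refine hind.mul_bdd (c := C) (hg.comp hXW).aestronglyMeasurable hC
  have hcond := condExp_mul_of_stronglyMeasurable_right hgm hgint hind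
  calc _ = ∫ ω, (P[(Y i ⁻¹' {y}).indicator (fun _ => (1 : ℝ)) * (fun ω => g (X i ω, W i ω)) |
      MeasurableSpace.comap (fun ω => (X i ω, W i ω)) inferInstance]) ω ∂P :=
        (integral_condExp hle).symm
    _ = _ := by
      refine integral_congr_ae ?_
      filter_upwards [hcond, h.condProb i y] with ω h1 h2
      rw [h1, Pi.mul_apply, h2]
      rfl

/-- The previous identity with g = 1 gives P(Y i = y) = 0 for each y > m i, and there are countably
many such y and i. -/
theorem IsSample.ae_le_trials (h : IsSample P m Y X W θ₀) : ∀ᵐ ω ∂P, ∀ i, Y i ω ≤ m i := by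
  rw [ae_all_iff]
  intro i
  have hy : ∀ y, m i < y → ∀ᵐ ω ∂P, Y i ω ≠ y := by
    intro y hy
    have h1 := h.integral_indicator_mul i y (g := fun _ => 1) measurable_const (C := 1) (by simp)
    simp only [obsProb_eq_zero hy, mul_one, integral_zero] at h1
    rw [integral_indicator_const _ (h.measurable_Y i (measurableSet_singleton y)), smul_eq_mul,
      mul_one, measureReal_eq_zero_iff] at h1
    rw [ae_iff]
    simp only [not_not]
    exact h1
  have hall : ∀ᵐ ω ∂P, ∀ y, m i < y → Y i ω ≠ y := ae_all_iff.2 fun y => by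
    by_cases hlt : m i < y
    · filter_upwards [hy y hlt] with ω hω _ using hω
    · exact Eventually.of_forall fun ω hlt' => absurd hlt' hlt
  filter_upwards [hall] with ω hω
  by_contra hcon
  exact hω (Y i ω) (not_le.1 hcon) rfl

/-- Expectations of functions of an observation, computed from the conditional law of the
response. -/
theorem IsSample.integral_eq_integral_sum (h : IsSample P m Y X W θ₀) (i : ℕ)
    {g : ℕ → EuclideanSpace ℝ (Fin p) × EuclideanSpace ℝ (Fin q) → ℝ}
    (hg : ∀ y, Measurable (g y)) {C : ℝ} (hC : ∀ᵐ ω ∂P, ∀ y, |g y (X i ω, W i ω)| ≤ C) :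
    ∫ ω, g (Y i ω) (X i ω, W i ω) ∂P =
      ∫ ω, ∑ y ∈ Finset.range (m i + 1),
        obsProb (m i) y (zeroPredictor θ₀ (X i ω)) (binomPredictor θ₀ (W i ω)) *
          g y (X i ω, W i ω) ∂P := by
  have hXW : Measurable fun ω => (X i ω, W i ω) := (h.measurable_X i).prodMk (h.measurable_W i)
  have hCy : ∀ y, ∀ᵐ ω ∂P, |g y (X i ω, W i ω)| ≤ C := fun y => by
    filter_upwards [hC] with ω hω using hω y
  have hP : Measurable fun ω => (zeroPredictor θ₀ (X i ω), binomPredictor θ₀ (W i ω)) :=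
    measurable_predictors measurable_const (h.measurable_X i) (h.measurable_W i)
  have h1 : ∫ ω, g (Y i ω) (X i ω, W i ω) ∂P = ∫ ω, ∑ y ∈ Finset.range (m i + 1),
      (Y i ⁻¹' {y}).indicator (fun _ => (1 : ℝ)) ω * g y (X i ω, W i ω) ∂P := by
    refine integral_congr_ae ?_
    filter_upwards [h.ae_le_trials] with ω hω
    rw [Finset.sum_eq_single (Y i ω)]
    · simp
    · intro y _ hy
      simp [Set.indicator, Ne.symm hy]
    · intro hn
      exact absurd (Finset.mem_range.2 (Nat.lt_succ_of_le (hω i))) hn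
  rw [h1, integral_finsetSum, integral_finsetSum]
  · exact Finset.sum_congr rfl fun y _ => h.integral_indicator_mul i y (hg y) (hCy y)
  · intro y hy
    have hpm : Measurable fun ω =>
        obsProb (m i) y (zeroPredictor θ₀ (X i ω)) (binomPredictor θ₀ (W i ω)) :=
      (continuous_obsProb (m i) y).measurable.comp hP
    refine Integrable.mul_bdd (c := C) (.of_bound hpm.aestronglyMeasurable 1 ?_)
      ((hg y).comp hXW).aestronglyMeasurable (hCy y)
    filter_upwards with ω
    have hpos : ∀ y' ∈ Finset.range (m i + 1),
        0 ≤ obsProb (m i) y' (zeroPredictor θ₀ (X i ω)) (binomPredictor θ₀ (W i ω)) :=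
      fun y' hy' => (obsProb_pos (Nat.lt_succ_iff.1 (Finset.mem_range.1 hy')) _ _).le
    rw [Real.norm_of_nonneg (hpos y hy),
      ← sum_obsProb (m i) (zeroPredictor θ₀ (X i ω)) (binomPredictor θ₀ (W i ω))]
    exact Finset.single_le_sum hpos hy
  · intro y _
    refine Integrable.mul_bdd (c := C) ?_ ((hg y).comp hXW).aestronglyMeasurable (hCy y)
    exact (integrable_const _).indicator (h.measurable_Y i (measurableSet_singleton y))

variable {r : ℝ}

theorem IsSample.integral_inner_obsScore (h : IsSample P m Y X W θ₀)
    (hr : ∀ᵐ ω ∂P, ∀ i, ‖X i ω‖ ≤ r ∧ ‖W i ω‖ ≤ r) (i : ℕ) (u : Param p q) :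
    ∫ ω, ⟪obsScore (m i) (Y i ω) (X i ω) (W i ω) θ₀, u⟫ ∂P = 0 := by
  obtain ⟨K, hK, hb⟩ := exists_bound_obsScore θ₀ (m i) r
  have key := h.integral_eq_integral_sum i
    (g := fun y z => ⟪obsScore (m i) y z.1 z.2 θ₀, u⟫) (C := K * ‖u‖)
    (fun y => (measurable_obsScore (m i) measurable_const measurable_const measurable_fst
      measurable_snd).inner_const)
    (by
      filter_upwards [hr] with ω hω y
      refine (abs_real_inner_le_norm _ _).trans ?_
      gcongr
      exact hb _ le_rfl _ _ _ (hω i).1 (hω i).2)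
  refine key.trans ?_
  simp only [inner_obsScore, sum_obsProb_mul_score, integral_zero]

theorem abs_inner_toEuclideanCLM_le {ι : Type*} [Fintype ι] [DecidableEq ι] (A : Matrix ι ι ℝ)
    (u : EuclideanSpace ℝ ι) :
    |⟪u, toEuclideanCLM (𝕜 := ℝ) A u⟫| ≤ ‖toEuclideanCLM (𝕜 := ℝ) A‖ * ‖u‖ ^ 2 := by
  refine (abs_real_inner_le_norm _ _).trans ?_
  have := (toEuclideanCLM (𝕜 := ℝ) A).le_opNorm u
  nlinarith [norm_nonneg u]

theorem measurable_inner_toEuclideanCLM {α ι : Type*} [MeasurableSpace α] [Fintype ι]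
    [DecidableEq ι] {A : α → Matrix ι ι ℝ} (hA : ∀ a b, Measurable fun ω => A ω a b)
    (u : EuclideanSpace ℝ ι) : Measurable fun ω => ⟪u, toEuclideanCLM (𝕜 := ℝ) (A ω) u⟫ := by
  simp only [inner_toEuclideanCLM, dotProduct, mulVec]
  fun_prop

/-- The information equality. -/
theorem IsSample.integral_inner_obsScore_sq (h : IsSample P m Y X W θ₀)
    (hr : ∀ᵐ ω ∂P, ∀ i, ‖X i ω‖ ≤ r ∧ ‖W i ω‖ ≤ r) (i : ℕ) (u : Param p q) :
    ∫ ω, ⟪obsScore (m i) (Y i ω) (X i ω) (W i ω) θ₀, u⟫ ^ 2 ∂P =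
      -∫ ω, ⟪u, toEuclideanCLM (𝕜 := ℝ) (obsHess (m i) (Y i ω) (X i ω) (W i ω) θ₀) u⟫ ∂P := by
  obtain ⟨K, hK, hb⟩ := exists_bound_obsScore θ₀ (m i) r
  obtain ⟨K', hK', hb'⟩ := exists_bound_obsHess θ₀ (m i) r
  have hsb : ∀ᵐ ω ∂P, ∀ y, |⟪obsScore (m i) y (X i ω) (W i ω) θ₀, u⟫ ^ 2| ≤ (K * ‖u‖) ^ 2 := by
    filter_upwards [hr] with ω hω y
    rw [abs_pow]
    gcongr
    refine (abs_real_inner_le_norm _ _).trans ?_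
    gcongr
    exact hb _ le_rfl _ _ _ (hω i).1 (hω i).2
  have hhb : ∀ᵐ ω ∂P, ∀ y, |⟪u, toEuclideanCLM (𝕜 := ℝ) (obsHess (m i) y (X i ω) (W i ω) θ₀) u⟫| ≤
      K' * ‖u‖ ^ 2 := by
    filter_upwards [hr] with ω hω y
    refine (abs_inner_toEuclideanCLM_le _ _).trans ?_
    gcongr
    exact hb' _ le_rfl _ _ _ (hω i).1 (hω i).2
  have hsm : ∀ {α : Type _} [MeasurableSpace α] {y : α → ℕ} {x : α → EuclideanSpace ℝ (Fin p)}
      {w : α → EuclideanSpace ℝ (Fin q)}, Measurable y → Measurable x → Measurable w →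
      Measurable fun ω => ⟪obsScore (m i) (y ω) (x ω) (w ω) θ₀, u⟫ ^ 2 :=
    fun hy hx hw => ((measurable_obsScore (m i) hy measurable_const hx hw).inner_const).pow_const 2
  have hhm : ∀ {α : Type _} [MeasurableSpace α] {y : α → ℕ} {x : α → EuclideanSpace ℝ (Fin p)}
      {w : α → EuclideanSpace ℝ (Fin q)}, Measurable y → Measurable x → Measurable w →
      Measurable fun ω => ⟪u, toEuclideanCLM (𝕜 := ℝ) (obsHess (m i) (y ω) (x ω) (w ω) θ₀) u⟫ :=
    fun hy hx hw => measurable_inner_toEuclideanCLM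
      (fun a b => measurable_obsHess (m i) hy measurable_const hx hw a b) u
  have hY := h.measurable_Y i
  have hXm := h.measurable_X i
  have hWm := h.measurable_W i
  have hint1 : Integrable (fun ω => ⟪obsScore (m i) (Y i ω) (X i ω) (W i ω) θ₀, u⟫ ^ 2) P := by
    refine .of_bound (((measurable_obsScore (m i) hY measurable_const hXm
      hWm).inner_const).pow_const 2).aestronglyMeasurable ((K * ‖u‖) ^ 2) ?_
    filter_upwards [hsb] with ω hω using hω _
  have hint2 : Integrable (fun ω =>
      ⟪u, toEuclideanCLM (𝕜 := ℝ) (obsHess (m i) (Y i ω) (X i ω) (W i ω) θ₀) u⟫) P := by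
    refine .of_bound (measurable_inner_toEuclideanCLM
      (fun a b => measurable_obsHess (m i) hY measurable_const hXm hWm a b)
      u).aestronglyMeasurable (K' * ‖u‖ ^ 2) ?_
    filter_upwards [hhb] with ω hω using hω _
  rw [eq_neg_iff_add_eq_zero, ← integral_add hint1 hint2]
  -- Squared score and Hessian are averaged together, so that the sum over y vanishes pointwise in
  -- the covariates.
  have key := h.integral_eq_integral_sum i
    (g := fun y z => ⟪obsScore (m i) y z.1 z.2 θ₀, u⟫ ^ 2 +
      ⟪u, toEuclideanCLM (𝕜 := ℝ) (obsHess (m i) y z.1 z.2 θ₀) u⟫)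
    (C := (K * ‖u‖) ^ 2 + K' * ‖u‖ ^ 2)
    (fun y => (hsm measurable_const measurable_fst measurable_snd).add
      (hhm measurable_const measurable_fst measurable_snd))
    (by
      filter_upwards [hsb, hhb] with ω h1 h2 y
      exact (abs_add_le _ _).trans (add_le_add (h1 y) (h2 y)))
  refine key.trans ?_
  simp only [inner_obsScore, inner_toEuclideanCLM_obsHess, sum_obsProb_mul_score_sq_add,
    integral_zero]

end Moments

/-! ### The Fisher information matrix -/

section Fisher

open Matrix
open scoped RealInnerProductSpace

variable {Ω : Type*} [MeasurableSpace Ω] {p q : ℕ}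

/-- The Fisher information matrix of a sample of size `n`: the expectation of the observed
information matrix at the true parameter. -/
def fisherInfo (P : Measure Ω) (m : ℕ → ℕ) (Y : ℕ → Ω → ℕ)
    (X : ℕ → Ω → EuclideanSpace ℝ (Fin p)) (W : ℕ → Ω → EuclideanSpace ℝ (Fin q))
    (θ₀ : Param p q) (n : ℕ) : Matrix (Fin p ⊕ Fin q) (Fin p ⊕ Fin q) ℝ :=
  of fun a b => -∑ i ∈ Finset.range n, ∫ ω, obsHess (m i) (Y i ω) (X i ω) (W i ω) θ₀ a b ∂P

variable {P : Measure Ω} {m : ℕ → ℕ} {Y : ℕ → Ω → ℕ} {X : ℕ → Ω → EuclideanSpace ℝ (Fin p)}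
  {W : ℕ → Ω → EuclideanSpace ℝ (Fin q)} {θ₀ : Param p q} {r : ℝ}

theorem isHermitian_fisherInfo (n : ℕ) : (fisherInfo P m Y X W θ₀ n).IsHermitian := by
  ext a b
  simp only [fisherInfo, conjTranspose_apply, of_apply, star_trivial, neg_inj]
  refine Finset.sum_congr rfl fun i _ => integral_congr_ae (Eventually.of_forall fun ω => ?_)
  exact (isHermitian_obsHess (m i) (Y i ω) (X i ω) (W i ω) θ₀).apply a b

theorem tendstoInMeasure_of_le_sum {κ : Type*} (s : Finset κ) {f : ℕ → Ω → ℝ}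
    {g : κ → ℕ → Ω → ℝ} (hg : ∀ j ∈ s, TendstoInMeasure P (g j) atTop 0)
    (hfg : ∀ n ω, |f n ω| ≤ ∑ j ∈ s, |g j n ω|) : TendstoInMeasure P f atTop 0 := by
  rw [tendstoInMeasure_iff_norm]
  intro ε hε
  -- If every term were below ε / N, the sum would be strictly below ε; the extra 1 gives strictness
  -- and covers empty s.
  set N : ℝ := s.card + 1
  have hN : 0 < N := by positivity
  have hlim : Tendsto (fun n => ∑ j ∈ s, P {ω | ε / N ≤ ‖g j n ω - (0 : Ω → ℝ) ω‖}) atTop (𝓝 0) := by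
    have := tendsto_finsetSum s fun j hj =>
      (tendstoInMeasure_iff_norm.1 (hg j hj)) (ε / N) (by positivity)
    simpa using this
  refine tendsto_of_tendsto_of_tendsto_of_le_of_le tendsto_const_nhds hlim (fun _ => zero_le)
    fun n => ?_
  refine (measure_mono ?_).trans (measure_biUnion_finset_le s _)
  intro ω hω
  simp only [Set.mem_ofPred_eq, Pi.zero_apply, sub_zero, Set.mem_iUnion, Real.norm_eq_abs] at hω ⊢
  by_contra! hcon
  have h1 : ∑ j ∈ s, |g j n ω| ≤ s.card • (ε / N) :=
    Finset.sum_le_card_nsmul _ _ _ fun j hj => (hcon j hj).le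
  have h2 : s.card • (ε / N) < ε := by
    rw [nsmul_eq_mul, mul_div_assoc', div_lt_iff₀ hN]
    simp only [N]; nlinarith
  linarith [hfg n ω]

theorem abs_apply_le_norm_toEuclideanCLM {ι : Type*} [Fintype ι] [DecidableEq ι]
    (A : Matrix ι ι ℝ) (a b : ι) : |A a b| ≤ ‖toEuclideanCLM (𝕜 := ℝ) A‖ := by
  have h : A a b = toEuclideanCLM (𝕜 := ℝ) A (EuclideanSpace.single b 1) a := by
    rw [ofLp_toEuclideanCLM]; simp
  rw [h, ← Real.norm_eq_abs]
  refine (PiLp.norm_apply_le _ _).trans (((toEuclideanCLM (𝕜 := ℝ) A).le_opNorm _).trans ?_)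
  simp

/-! ### Linear growth of the Fisher information and concentration of the observed information -/

variable [NeZero p] [NeZero q]

theorem IsSample.ae_abs_obsHess_le (h : IsSample P m Y X W θ₀)
    (hr : ∀ᵐ ω ∂P, ∀ i, ‖X i ω‖ ≤ r ∧ ‖W i ω‖ ≤ r) :
    ∃ K, 0 ≤ K ∧ ∀ᵐ ω ∂P, ∀ i,
      ‖toEuclideanCLM (𝕜 := ℝ) (obsHess (m i) (Y i ω) (X i ω) (W i ω) θ₀)‖ ≤ K := by
  obtain ⟨M, hM⟩ := h.trials_bdd
  obtain ⟨K, hK, hb⟩ := exists_bound_obsHess θ₀ M r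
  refine ⟨K, hK, ?_⟩
  filter_upwards [hr] with ω hω i
  exact hb _ (hM i) _ _ _ (hω i).1 (hω i).2

variable [IsProbabilityMeasure P]

theorem IsSample.integrable_obsHess (h : IsSample P m Y X W θ₀)
    (hr : ∀ᵐ ω ∂P, ∀ i, ‖X i ω‖ ≤ r ∧ ‖W i ω‖ ≤ r) (i : ℕ) (a b : Fin p ⊕ Fin q) :
    Integrable (fun ω => obsHess (m i) (Y i ω) (X i ω) (W i ω) θ₀ a b) P := by
  obtain ⟨K, -, hK⟩ := h.ae_abs_obsHess_le hr
  refine .of_bound (measurable_obsHess (m i) (h.measurable_Y i) measurable_const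
    (h.measurable_X i) (h.measurable_W i) a b).aestronglyMeasurable K ?_
  filter_upwards [hK] with ω hω
  exact (abs_apply_le_norm_toEuclideanCLM _ a b).trans (hω i)

/-- The summed information equality: the Fisher information is the covariance matrix of the score.
-/
theorem IsSample.inner_fisherInfo (h : IsSample P m Y X W θ₀)
    (hr : ∀ᵐ ω ∂P, ∀ i, ‖X i ω‖ ≤ r ∧ ‖W i ω‖ ≤ r) (n : ℕ) (u : Param p q) :
    ⟪u, toEuclideanCLM (𝕜 := ℝ) (fisherInfo P m Y X W θ₀ n) u⟫ =
      ∑ i ∈ Finset.range n, ∫ ω, ⟪obsScore (m i) (Y i ω) (X i ω) (W i ω) θ₀, u⟫ ^ 2 ∂P := by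
  have hint : ∀ i a b, Integrable (fun ω =>
      u a * (obsHess (m i) (Y i ω) (X i ω) (W i ω) θ₀ a b * u b)) P :=
    fun i a b => ((h.integrable_obsHess hr i a b).mul_const _).const_mul _
  have h1 : ∀ i, ∫ ω, ⟪obsScore (m i) (Y i ω) (X i ω) (W i ω) θ₀, u⟫ ^ 2 ∂P =
      -∑ a, ∑ b, u a * ((∫ ω, obsHess (m i) (Y i ω) (X i ω) (W i ω) θ₀ a b ∂P) * u b) := by
    intro i
    rw [h.integral_inner_obsScore_sq hr]
    simp only [inner_toEuclideanCLM, dotProduct, mulVec, Finset.mul_sum]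
    rw [integral_finsetSum _ fun a _ => integrable_finsetSum _ fun b _ => hint i a b]
    congr 1
    refine Finset.sum_congr rfl fun a _ => ?_
    rw [integral_finsetSum _ fun b _ => hint i a b]
    refine Finset.sum_congr rfl fun b _ => ?_
    rw [integral_const_mul, integral_mul_const]
  simp only [h1]
  rw [inner_toEuclideanCLM]
  simp only [dotProduct, mulVec, fisherInfo, of_apply, Finset.mul_sum, neg_mul, mul_neg,
    Finset.sum_neg_distrib, Finset.sum_mul]
  congr 1
  rw [Finset.sum_comm' (t' := Finset.univ) (s' := fun _ => Finset.range n) (by simp)]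
  refine Finset.sum_congr rfl fun a _ => ?_
  rw [Finset.sum_comm]

/-- This is the share of the outcome y = 0 in the variance of the a-derivative. It is positive
because the normal density is positive and (1 - F b)^m < 1, which needs m ≥ 1; compactness makes the
bound uniform. -/
theorem exists_pos_le_obsProb_mul_sq (M : ℕ) (R : ℝ) :
    ∃ κ > 0, ∀ m, 1 ≤ m → m ≤ M → ∀ z : ℝ × ℝ, ‖z‖ ≤ R →
      κ ≤ obsProb m 0 z.1 z.2 * relDeriv m 0 1 0 z.1 z.2 ^ 2 := by
  have hpos : ∀ m, 1 ≤ m → ∀ z : ℝ × ℝ,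
      0 < obsProb m 0 z.1 z.2 * relDeriv m 0 1 0 z.1 z.2 ^ 2 := by
    intro m hm z
    have hP := obsProb_pos (Nat.zero_le m) z.1 z.2
    have hB : binomShift m 0 0 z.2 < 0 := by
      have h1 : (1 - stdNormalCDF z.2) ^ m < 1 :=
        pow_lt_one₀ (sub_pos.2 (stdNormalCDF_lt_one _)).le (by linarith [stdNormalCDF_pos z.2])
          (by omega)
      simpa [binomShift, bernsteinPolynomial] using h1
    have hZ : zeroTail 1 z.1 < 0 := neg_neg_of_pos (stdNormalPDF_pos _)
    have : relDeriv m 0 1 0 z.1 z.2 ≠ 0 :=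
      div_ne_zero (mul_ne_zero hZ.ne hB.ne) hP.ne'
    positivity
  -- An upper bound for the reciprocal gives the lower bound. The case distinction supplies a family
  -- that vanishes for m < y.
  obtain ⟨K, hK0, hK⟩ := exists_bound_of_continuous
    (f := fun m y z => if 1 ≤ m ∧ y = 0 then
      (obsProb m 0 z.1 z.2 * relDeriv m 0 1 0 z.1 z.2 ^ 2)⁻¹ else 0)
    (fun m y => by
      by_cases h : 1 ≤ m ∧ y = 0
      · simp only [h, and_self, if_true]
        exact ((continuous_obsProb m 0).mul ((continuous_relDeriv m 0 1 0).pow 2)).inv₀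
          fun z => (hpos m h.1 z).ne'
      · simp only [h, if_false]; exact continuous_const)
    (fun m y h z => if_neg (by omega)) M R
  refine ⟨(K + 1)⁻¹, by positivity, fun m hm1 hmM z hz => ?_⟩
  have h1 := hK m hmM 0 z hz
  simp only [hm1, and_self, if_true] at h1
  rw [abs_of_pos (inv_pos.2 (hpos m hm1 z))] at h1
  exact (inv_le_comm₀ (by positivity) (hpos m hm1 z)).2 (h1.trans (by linarith))

/-- The direction is the intercept of the zero-inflation component: whatever the covariates, its
predictors are 1 and 0, so the y = 0 term of the previous bound applies directly. -/
theorem IsSample.exists_le_inner_fisherInfo (h : IsSample P m Y X W θ₀)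
    (hr : ∀ᵐ ω ∂P, ∀ i, ‖X i ω‖ ≤ r ∧ ‖W i ω‖ ≤ r) :
    ∃ κ > 0, ∃ e : Param p q, ‖e‖ = 1 ∧ ∀ n : ℕ,
      κ * n ≤ ⟪e, toEuclideanCLM (𝕜 := ℝ) (fisherInfo P m Y X W θ₀ n) e⟫ := by
  obtain ⟨M, hM⟩ := h.trials_bdd
  obtain ⟨κ, hκ, hle⟩ := exists_pos_le_obsProb_mul_sq M (r * ‖θ₀‖)
  refine ⟨κ, hκ, EuclideanSpace.single (Sum.inl 0) 1, by simp, fun n => ?_⟩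
  set e : Param p q := EuclideanSpace.single (Sum.inl 0) 1
  have he1 : ∀ i ω, zeroPredictor e (X i ω) = 1 := fun i ω => by
    rw [zeroPredictor, Finset.sum_eq_single 0]
    · simp [betaPart, e, h.intercept_X]
    · intro j _ hj; simp [betaPart, e, hj]
    · simp
  have he2 : ∀ i ω, binomPredictor e (W i ω) = 0 := fun i ω => by
    simp [binomPredictor, muPart, e]
  have hone : ∀ i, κ ≤ ∫ ω, ⟪obsScore (m i) (Y i ω) (X i ω) (W i ω) θ₀, e⟫ ^ 2 ∂P := by
    intro i
    obtain ⟨K, hK, hb⟩ := exists_bound_obsScore θ₀ (m i) r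
    have key := h.integral_eq_integral_sum i
      (g := fun y z => ⟪obsScore (m i) y z.1 z.2 θ₀, e⟫ ^ 2) (C := (K * ‖e‖) ^ 2)
      (fun y => (measurable_obsScore (m i) measurable_const measurable_const measurable_fst
        measurable_snd).inner_const.pow_const 2)
      (by
        filter_upwards [hr] with ω hω y
        rw [abs_pow]
        gcongr
        refine (abs_real_inner_le_norm _ _).trans ?_
        gcongr
        exact hb _ le_rfl _ _ _ (hω i).1 (hω i).2)
    rw [key]
    have hXm := h.measurable_X i
    have hWm := h.measurable_W i
    have hpm : ∀ y, Measurable fun ω =>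
        obsProb (m i) y (zeroPredictor θ₀ (X i ω)) (binomPredictor θ₀ (W i ω)) := fun y =>
      (continuous_obsProb (m i) y).measurable.comp (measurable_predictors measurable_const hXm hWm)
    have hsm : ∀ y, Measurable fun ω => ⟪obsScore (m i) y (X i ω) (W i ω) θ₀, e⟫ ^ 2 := fun y =>
      (measurable_obsScore (m i) measurable_const measurable_const hXm hWm).inner_const.pow_const 2
    have hterm : ∀ y ∈ Finset.range (m i + 1), ∀ ω,
        0 ≤ obsProb (m i) y (zeroPredictor θ₀ (X i ω)) (binomPredictor θ₀ (W i ω)) *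
          ⟪obsScore (m i) y (X i ω) (W i ω) θ₀, e⟫ ^ 2 := fun y hy ω =>
      mul_nonneg (obsProb_pos (Nat.lt_succ_iff.1 (Finset.mem_range.1 hy)) _ _).le (sq_nonneg _)
    have hbd : ∀ᵐ ω ∂P, κ ≤ ∑ y ∈ Finset.range (m i + 1),
        obsProb (m i) y (zeroPredictor θ₀ (X i ω)) (binomPredictor θ₀ (W i ω)) *
          ⟪obsScore (m i) y (X i ω) (W i ω) θ₀, e⟫ ^ 2 := by
      filter_upwards [hr] with ω hω
      refine le_trans ?_ (Finset.single_le_sum (fun y hy => hterm y hy ω)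
        (Finset.mem_range.2 (Nat.succ_pos (m i))))
      rw [inner_obsScore, he1, he2, mul_one, mul_zero, add_zero]
      exact hle (m i) (h.trials_pos i) (hM i) (_, _) (norm_predictors_le (hω i).1 (hω i).2 θ₀)
    have hub : ∀ᵐ ω ∂P, ∑ y ∈ Finset.range (m i + 1),
        obsProb (m i) y (zeroPredictor θ₀ (X i ω)) (binomPredictor θ₀ (W i ω)) *
          ⟪obsScore (m i) y (X i ω) (W i ω) θ₀, e⟫ ^ 2 ≤ (K * ‖e‖) ^ 2 := by
      filter_upwards [hr] with ω hω
      have hs : ∀ y, ⟪obsScore (m i) y (X i ω) (W i ω) θ₀, e⟫ ^ 2 ≤ (K * ‖e‖) ^ 2 := by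
        intro y
        rw [← sq_abs]
        gcongr
        refine (abs_real_inner_le_norm _ _).trans ?_
        gcongr
        exact hb _ le_rfl _ _ _ (hω i).1 (hω i).2
      refine (Finset.sum_le_sum fun y hy => mul_le_mul_of_nonneg_left (hs y)
        (obsProb_pos (Nat.lt_succ_iff.1 (Finset.mem_range.1 hy)) _ _).le).trans ?_
      rw [← Finset.sum_mul, sum_obsProb, one_mul]
    have hint : Integrable (fun ω => ∑ y ∈ Finset.range (m i + 1),
        obsProb (m i) y (zeroPredictor θ₀ (X i ω)) (binomPredictor θ₀ (W i ω)) *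
          ⟪obsScore (m i) y (X i ω) (W i ω) θ₀, e⟫ ^ 2) P := by
      refine .of_bound (Finset.measurable_fun_sum _ fun y _ =>
        (hpm y).mul (hsm y)).aestronglyMeasurable ((K * ‖e‖) ^ 2) ?_
      filter_upwards [hub] with ω hω
      rwa [Real.norm_of_nonneg (Finset.sum_nonneg fun y hy => hterm y hy ω)]
    simpa using integral_mono_ae (integrable_const κ) hint hbd
  rw [h.inner_fisherInfo hr]
  have := Finset.card_nsmul_le_sum (Finset.range n) _ κ fun i _ => hone i
  simpa [mul_comm] using this

/-- The law of large numbers for the observed information matrix. -/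
theorem IsSample.tendstoInMeasure_observedInfo_sub (h : IsSample P m Y X W θ₀)
    (hr : ∀ᵐ ω ∂P, ∀ i, ‖X i ω‖ ≤ r ∧ ‖W i ω‖ ≤ r) :
    TendstoInMeasure P (fun (n : ℕ) ω =>
      ‖toEuclideanCLM (𝕜 := ℝ) (observedInfo m (Y · ω) (X · ω) (W · ω) n θ₀) -
        toEuclideanCLM (𝕜 := ℝ) (fisherInfo P m Y X W θ₀ n)‖ / n) atTop 0 := by
  obtain ⟨K, -, hK⟩ := h.ae_abs_obsHess_le hr
  have hw : ∀ a b, TendstoInMeasure P (fun (n : ℕ) ω =>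
      (∑ i ∈ Finset.range n, obsHess (m i) (Y i ω) (X i ω) (W i ω) θ₀ a b -
        ∑ i ∈ Finset.range n, ∫ ω, obsHess (m i) (Y i ω) (X i ω) (W i ω) θ₀ a b ∂P) / n)
      atTop 0 := by
    intro a b
    refine tendstoInMeasure_sum_sub_integral_div (K := K) (fun i => ?_) ?_ fun i => ?_
    · exact measurable_obsHess (m i) (h.measurable_Y i) measurable_const (h.measurable_X i)
        (h.measurable_W i) a b
    · exact h.indep.comp (fun i t => obsHess (m i) t.1 t.2.1 t.2.2 θ₀ a b) fun i =>
        measurable_obsHess (m i) measurable_fst measurable_const (measurable_fst.comp measurable_snd)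
          (measurable_snd.comp measurable_snd) a b
    · filter_upwards [hK] with ω hω
      exact (abs_apply_le_norm_toEuclideanCLM _ a b).trans (hω i)
  refine tendstoInMeasure_of_le_sum (Finset.univ : Finset ((Fin p ⊕ Fin q) × (Fin p ⊕ Fin q)))
    (g := fun c n ω => (∑ i ∈ Finset.range n, obsHess (m i) (Y i ω) (X i ω) (W i ω) θ₀ c.1 c.2 -
        ∑ i ∈ Finset.range n, ∫ ω, obsHess (m i) (Y i ω) (X i ω) (W i ω) θ₀ c.1 c.2 ∂P) / n)
    (fun c _ => hw c.1 c.2) fun n ω => ?_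
  rw [abs_of_nonneg (by positivity)]
  simp only [abs_div, Nat.abs_cast, ← Finset.sum_div]
  gcongr
  rw [← map_sub]
  refine (norm_toEuclideanCLM_le_sum _).trans (le_of_eq ?_)
  rw [Fintype.sum_prod_type]
  refine Finset.sum_congr rfl fun a _ => Finset.sum_congr rfl fun b _ => ?_
  rw [observedInfo_eq_neg_sum, Matrix.sub_apply, Matrix.neg_apply, Matrix.sum_apply, fisherInfo,
    of_apply, ← neg_sub', abs_neg]

/-- Under the condition on the eigenvalues of the observed information matrix, the Fisher
information grows at least linearly in every direction. -/
theorem IsSample.exists_eventually_le_inner_fisherInfo (h : IsSample P m Y X W θ₀)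
    (hr : ∀ᵐ ω ∂P, ∀ i, ‖X i ω‖ ≤ r ∧ ‖W i ω‖ ≤ r) (hcond : WellConditioned P m Y X W θ₀) :
    ∃ c > 0, ∀ᶠ n : ℕ in atTop, ∀ u : Param p q,
      c * n * ‖u‖ ^ 2 ≤ ⟪u, toEuclideanCLM (𝕜 := ℝ) (fisherInfo P m Y X W θ₀ n) u⟫ := by
  obtain ⟨κ, hκ, e, he, hκe⟩ := h.exists_le_inner_fisherInfo hr
  obtain ⟨c₂, hc₂, hae⟩ := hcond
  refine ⟨κ / (4 * c₂), by positivity, ?_⟩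
  -- The Fisher information is deterministic, so one good ω suffices. If the bound failed infinitely
  -- often, a further subsequence would make the law of large numbers almost sure, and at some ω and
  -- index the condition number bound would hold too.
  by_contra hcon
  obtain ⟨φ, hφ, hφn⟩ := extraction_of_frequently_atTop (not_eventually.1 hcon)
  obtain ⟨ψ, hψ, hψae⟩ := ((h.tendstoInMeasure_observedInfo_sub hr).comp
    hφ.tendsto_atTop).exists_seq_tendsto_ae
  obtain ⟨ω, hω1, hω2, hω3⟩ := (hψae.and (hae.and h.ae_le_trials)).exists
  -- κ / 2 leaves the largest eigenvalue of S at least κ N / 2, so the smallest is at least κ N / (2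
  -- c₂). Half of that is left on returning to V if η ≤ κ / (4 c₂).
  set η := min (κ / 2) (κ / (4 * c₂)) with hη
  have hη0 : 0 < η := by positivity
  have hsub : Tendsto (fun k => φ (ψ k)) atTop atTop := hφ.tendsto_atTop.comp hψ.tendsto_atTop
  obtain ⟨k, hk1, hk2, hk3⟩ := ((hω1.eventually_lt_const (u := η) (by simpa using hη0)).and
    ((hsub.eventually hω2).and (hsub.eventually_gt_atTop 0))).exists
  refine hφn (ψ k) fun u => ?_
  set N := φ (ψ k)
  have hN : (0 : ℝ) < N := by exact_mod_cast hk3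
  set S := observedInfo m (Y · ω) (X · ω) (W · ω) N θ₀ with hS
  set V := fisherInfo P m Y X W θ₀ N with hV
  have hdist : ‖toEuclideanCLM (𝕜 := ℝ) S - toEuclideanCLM (𝕜 := ℝ) V‖ ≤ η * N := by
    have : ‖toEuclideanCLM (𝕜 := ℝ) S - toEuclideanCLM (𝕜 := ℝ) V‖ / N < η := hk1
    rw [div_lt_iff₀ hN] at this
    exact this.le
  have hquad : ∀ v : Param p q, |⟪v, toEuclideanCLM (𝕜 := ℝ) S v⟫ -
      ⟪v, toEuclideanCLM (𝕜 := ℝ) V v⟫| ≤ η * N * ‖v‖ ^ 2 := by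
    intro v
    rw [← inner_sub_right, ← _root_.sub_apply, ← map_sub]
    refine (abs_inner_toEuclideanCLM_le _ _).trans ?_
    rw [map_sub]
    gcongr
  have hSpd : S.PosDef := by
    rw [hS, observedInfo_eq_neg_hessian hω3]; exact hk2.1
  have hmin : 0 < minEigenvalue S := minEigenvalue_pos hSpd
  have hmax : κ / 2 * N ≤ maxEigenvalue S := by
    have h1 := inner_le_maxEigenvalue_mul_norm_sq hSpd.1 e
    have h2 := hκe N
    have h3 := (abs_le.1 (hquad e)).1
    have h4 : η ≤ κ / 2 := min_le_left _ _
    rw [he] at h1 h3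
    nlinarith
  have hratio : maxEigenvalue S < c₂ * minEigenvalue S := by
    have := hk2.2
    rwa [div_lt_iff₀ hmin] at this
  have hlow : κ / (2 * c₂) * N ≤ minEigenvalue S := by
    have : κ / (2 * c₂) * N = κ / 2 * N / c₂ := by field_simp
    rw [this, div_le_iff₀ hc₂]
    linarith
  have h1 := minEigenvalue_mul_norm_sq_le_inner hSpd.1 u
  have h2 := (abs_le.1 (hquad u)).2
  have h4 : η ≤ κ / (4 * c₂) := min_le_right _ _
  have h5 : κ / (2 * c₂) = κ / (4 * c₂) + κ / (4 * c₂) := by field_simp; norm_num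
  have h6 : κ / (2 * c₂) * N * ‖u‖ ^ 2 ≤ minEigenvalue S * ‖u‖ ^ 2 := by gcongr
  have h7 : η * N * ‖u‖ ^ 2 ≤ κ / (4 * c₂) * N * ‖u‖ ^ 2 := by gcongr
  rw [h5] at h6
  linarith

end Fisher

/-! ### Asymptotic normality -/

section Normality

open Matrix
open scoped RealInnerProductSpace

theorem measurable_norm_toEuclideanCLM {α ι : Type*} [MeasurableSpace α] [Fintype ι]
    [DecidableEq ι] {A : α → Matrix ι ι ℝ} (hA : ∀ a b, Measurable fun ω => A ω a b) :
    Measurable fun ω => ‖toEuclideanCLM (𝕜 := ℝ) (A ω)‖ := by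
  let _ : MeasurableSpace (Matrix ι ι ℝ) := MeasurableSpace.pi
  have : BorelSpace (Matrix ι ι ℝ) := inferInstanceAs (BorelSpace (ι → ι → ℝ))
  have hT : Continuous fun A : Matrix ι ι ℝ => toEuclideanCLM (𝕜 := ℝ) A :=
    (toEuclideanCLM (𝕜 := ℝ) (n := ι)).toAlgEquiv.toLinearMap.continuous_of_finiteDimensional
  have hAm : Measurable A := measurable_pi_lambda _ fun i => measurable_pi_lambda _ fun j => hA i j
  exact hT.norm.measurable.comp hAm

theorem measurable_toEuclideanCLM_apply {α ι : Type*} [MeasurableSpace α] [Fintype ι]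
    [DecidableEq ι] {A : α → Matrix ι ι ℝ} (hA : ∀ a b, Measurable fun ω => A ω a b)
    {v : α → EuclideanSpace ℝ ι} (hv : Measurable v) :
    Measurable fun ω => toEuclideanCLM (𝕜 := ℝ) (A ω) (v ω) := by
  have h : Measurable fun ω => A ω *ᵥ (v ω).ofLp := measurable_pi_lambda _ fun a => by
    simp only [mulVec, dotProduct]
    fun_prop
  exact (WithLp.measurable_toLp 2 _).comp h

theorem toEuclideanCLM_sqrt_inv_apply {ι : Type*} [Fintype ι] [DecidableEq ι] {V : Matrix ι ι ℝ}
    (hV : V.PosDef) (x : EuclideanSpace ℝ ι) :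
    toEuclideanCLM (𝕜 := ℝ) (CFC.sqrt V) (toEuclideanCLM (𝕜 := ℝ) (CFC.sqrt V)⁻¹ x) = x := by
  have hdet : IsUnit (CFC.sqrt V).det := by
    have h1 : (CFC.sqrt V).det * (CFC.sqrt V).det = V.det := by
      rw [← det_mul, CFC.sqrt_mul_sqrt_self V hV.posSemidef.nonneg]
    refine isUnit_iff_ne_zero.2 fun h0 => hV.det_pos.ne' ?_
    rw [← h1, h0, zero_mul]
  have h := congrArg (fun L => L x) (map_mul (toEuclideanCLM (𝕜 := ℝ)) (CFC.sqrt V) (CFC.sqrt V)⁻¹)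
  rw [mul_nonsing_inv _ hdet, map_one] at h
  exact h.symm

theorem posDef_of_le_inner {ι : Type*} [Fintype ι] [DecidableEq ι] {V : Matrix ι ι ℝ}
    (hV : V.IsHermitian) {c : ℝ} (hc : 0 < c)
    (h : ∀ u : EuclideanSpace ℝ ι, c * ‖u‖ ^ 2 ≤ ⟪u, toEuclideanCLM (𝕜 := ℝ) V u⟫) : V.PosDef := by
  rw [posDef_iff_dotProduct_mulVec]
  refine ⟨hV, fun x hx => ?_⟩
  have h1 := h (WithLp.toLp 2 x)
  rw [inner_toEuclideanCLM] at h1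
  have h2 : 0 < ‖WithLp.toLp 2 x‖ := norm_pos_iff.2 (by simpa using hx)
  have h3 : 0 < c * ‖WithLp.toLp 2 x‖ ^ 2 := by positivity
  simpa using h3.trans_le h1

variable {Ω : Type*} [MeasurableSpace Ω] {P : Measure Ω} {p q : ℕ}
  [NeZero p] [NeZero q] {m : ℕ → ℕ} {Y : ℕ → Ω → ℕ} {X : ℕ → Ω → EuclideanSpace ℝ (Fin p)}
  {W : ℕ → Ω → EuclideanSpace ℝ (Fin q)} {θ₀ : Param p q} {θhat : ℕ → Ω → Param p q} {r : ℝ}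

/-- The score of a sample of size `n` at the true parameter. -/
def trueScore (m : ℕ → ℕ) (Y : ℕ → Ω → ℕ) (X : ℕ → Ω → EuclideanSpace ℝ (Fin p))
    (W : ℕ → Ω → EuclideanSpace ℝ (Fin q)) (θ₀ : Param p q) (n : ℕ) (ω : Ω) : Param p q :=
  ∑ i ∈ Finset.range n, obsScore (m i) (Y i ω) (X i ω) (W i ω) θ₀

theorem IsSample.measurable_trueScore (h : IsSample P m Y X W θ₀) (n : ℕ) :
    Measurable (trueScore m Y X W θ₀ n) :=
  Finset.measurable_fun_sum _ fun i _ => measurable_obsScore (m i) (h.measurable_Y i)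
    measurable_const (h.measurable_X i) (h.measurable_W i)

theorem IsSample.measurable_observedInfo (h : IsSample P m Y X W θ₀) {θ : Ω → Param p q}
    (hθ : Measurable θ) (n : ℕ) (a b : Fin p ⊕ Fin q) :
    Measurable fun ω => observedInfo m (Y · ω) (X · ω) (W · ω) n (θ ω) a b := by
  simp only [observedInfo_eq_neg_sum, Matrix.neg_apply, Matrix.sum_apply]
  exact (Finset.measurable_fun_sum _ fun i _ => measurable_obsHess (m i) (h.measurable_Y i)
    hθ (h.measurable_X i) (h.measurable_W i) a b).neg

theorem IsSample.measurable_normalizedEstimator (h : IsSample P m Y X W θ₀)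
    (hθ : ∀ n, Measurable (θhat n)) (n : ℕ) :
    Measurable (normalizedEstimator m Y X W θ₀ θhat n) :=
  measurable_toEuclideanCLM_sqrt_apply (h.measurable_observedInfo (hθ n) n) ((hθ n).sub_const _)

variable [IsProbabilityMeasure P]

/-- As the score vanishes at the estimator, its increment from θ₀ is minus the score at θ₀. The
exceptional null set does not depend on ε. -/
theorem IsSample.ae_eventually_linearization (h : IsSample P m Y X W θ₀)
    (hr : ∀ᵐ ω ∂P, ∀ i, ‖X i ω‖ ≤ r ∧ ‖W i ω‖ ≤ r) (hest : IsScoreEstimator P m Y X W θhat)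
    (hconsistent : ∀ᵐ ω ∂P, Tendsto (fun n => θhat n ω) atTop (𝓝 θ₀)) :
    ∀ᵐ ω ∂P, ∀ ε > 0, ∀ᶠ n : ℕ in atTop,
      ‖toEuclideanCLM (𝕜 := ℝ) (observedInfo m (Y · ω) (X · ω) (W · ω) n (θhat n ω) -
          observedInfo m (Y · ω) (X · ω) (W · ω) n θ₀)‖ ≤ ε * n ∧
      ‖trueScore m Y X W θ₀ n ω - toEuclideanCLM (𝕜 := ℝ)
          (observedInfo m (Y · ω) (X · ω) (W · ω) n (θhat n ω)) (θhat n ω - θ₀)‖ ≤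
        ε * n * ‖θhat n ω - θ₀‖ := by
  obtain ⟨M, hM⟩ := h.trials_bdd
  filter_upwards [hr, h.ae_le_trials, hest.score_eq_zero, hconsistent] with ω h1 h2 h3 h4 ε hε
  obtain ⟨δ, hδ, hlin⟩ := exists_delta_linearization θ₀ M r hε
  filter_upwards [h3, h4.eventually (Metric.closedBall_mem_nhds θ₀ hδ)] with n h5 h6
  rw [dist_eq_norm] at h6
  obtain ⟨h7, h8⟩ := hlin m (Y · ω) (X · ω) (W · ω) hM (fun i => (h1 i).1) (fun i => (h1 i).2) n _ h6
  refine ⟨by rwa [map_sub], ?_⟩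
  rw [score_eq_sum h2] at h5
  rw [h5, zero_sub, neg_add_eq_sub, norm_sub_rev] at h8
  exact h8

/-- The failure events almost surely stop occurring, so their indicators tend to 0 and so do their
probabilities. -/
theorem IsSample.tendsto_measure_not_linearization (h : IsSample P m Y X W θ₀)
    (hr : ∀ᵐ ω ∂P, ∀ i, ‖X i ω‖ ≤ r ∧ ‖W i ω‖ ≤ r) (hest : IsScoreEstimator P m Y X W θhat)
    (hconsistent : ∀ᵐ ω ∂P, Tendsto (fun n => θhat n ω) atTop (𝓝 θ₀)) {ε : ℝ} (hε : 0 < ε) :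
    Tendsto (fun n : ℕ => P {ω | ¬(
      ‖toEuclideanCLM (𝕜 := ℝ) (observedInfo m (Y · ω) (X · ω) (W · ω) n (θhat n ω) -
          observedInfo m (Y · ω) (X · ω) (W · ω) n θ₀)‖ ≤ ε * n ∧
      ‖trueScore m Y X W θ₀ n ω - toEuclideanCLM (𝕜 := ℝ)
          (observedInfo m (Y · ω) (X · ω) (W · ω) n (θhat n ω)) (θhat n ω - θ₀)‖ ≤
        ε * n * ‖θhat n ω - θ₀‖)}) atTop (𝓝 0) := by
  have hmI := fun n => h.measurable_observedInfo (hest.measurable n) n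
  have hm0 := fun n => h.measurable_observedInfo (θ := fun _ => θ₀) measurable_const n
  have hmh : ∀ n, Measurable fun ω => θhat n ω - θ₀ := fun n => (hest.measurable n).sub_const _
  rw [← measure_empty (μ := P)]
  refine tendsto_measure_of_ae_tendsto_indicator_of_isFiniteMeasure atTop MeasurableSet.empty
    (fun n => (MeasurableSet.inter ?_ ?_).compl) ?_
  · exact measurableSet_le (measurable_norm_toEuclideanCLM fun a b => (hmI n a b).sub (hm0 n a b))
      measurable_const
  · exact measurableSet_le ((h.measurable_trueScore n).sub (measurable_toEuclideanCLM_apply (hmI n)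
      (hmh n))).norm ((hmh n).norm.const_mul _)
  · filter_upwards [h.ae_eventually_linearization hr hest hconsistent] with ω hω
    filter_upwards [hω ε hε] with n hn
    exact iff_of_false (fun hcon => hcon hn) (Set.notMem_empty ω)

/-- The central limit theorem for the score. -/
theorem IsSample.tendstoInDistribution_trueScore (h : IsSample P m Y X W θ₀)
    (hr : ∀ᵐ ω ∂P, ∀ i, ‖X i ω‖ ≤ r ∧ ‖W i ω‖ ≤ r) {c : ℝ} (hc : 0 < c)
    (hV : ∀ᶠ n : ℕ in atTop, ∀ u : Param p q,
      c * n * ‖u‖ ^ 2 ≤ ⟪u, toEuclideanCLM (𝕜 := ℝ) (fisherInfo P m Y X W θ₀ n) u⟫) :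
    TendstoInDistribution (fun n ω => toEuclideanCLM (𝕜 := ℝ)
        (CFC.sqrt (fisherInfo P m Y X W θ₀ n))⁻¹ (trueScore m Y X W θ₀ n ω)) atTop
      (fun z : Param p q => z) (fun _ => P) (stdGaussian (Param p q)) := by
  obtain ⟨M, hM⟩ := h.trials_bdd
  obtain ⟨K, hK, hb⟩ := exists_bound_obsScore θ₀ M r
  -- Used twice: it is the variance normalization required by the central limit theorem, and
  -- combined with `hV` it bounds the size of V^(-1/2).
  have hkey : ∀ᶠ n : ℕ in atTop, ∀ u : Param p q,
      ⟪toEuclideanCLM (𝕜 := ℝ) (CFC.sqrt (fisherInfo P m Y X W θ₀ n))⁻¹ u,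
        toEuclideanCLM (𝕜 := ℝ) (fisherInfo P m Y X W θ₀ n)
          (toEuclideanCLM (𝕜 := ℝ) (CFC.sqrt (fisherInfo P m Y X W θ₀ n))⁻¹ u)⟫ = ‖u‖ ^ 2 := by
    filter_upwards [hV, eventually_gt_atTop 0] with n hn hn0 u
    have hn0' : (0 : ℝ) < n := by exact_mod_cast hn0
    have hpd := posDef_of_le_inner (isHermitian_fisherInfo n) (by positivity) hn
    rw [← norm_toEuclideanCLM_sqrt_sq hpd.posSemidef, toEuclideanCLM_sqrt_inv_apply hpd]
  refine tendstoInDistribution_apply_sum (K := K) (fun i => ?_) ?_ (fun i => ?_)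
    (fun i u => h.integral_inner_obsScore hr i u) (fun n x y => ?_) hc ?_ ?_
  · exact measurable_obsScore (m i) (h.measurable_Y i) measurable_const (h.measurable_X i)
      (h.measurable_W i)
  · exact h.indep.comp (fun i t => obsScore (m i) t.1 t.2.1 t.2.2 θ₀) fun i =>
      measurable_obsScore (m i) measurable_fst measurable_const (measurable_fst.comp measurable_snd)
        (measurable_snd.comp measurable_snd)
  · filter_upwards [hr] with ω hω
    exact hb _ (hM i) _ _ _ (hω i).1 (hω i).2
  · exact inner_toEuclideanCLM_comm (CFC.sqrt_nonneg _).posSemidef.1.inv x y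
  · filter_upwards [hV, hkey] with n h1 h2 u
    rw [← h2 u]
    exact h1 _
  · filter_upwards [hkey] with n h2 u
    rw [← h.inner_fisherInfo hr, h2 u]

/-- The normalized estimator and the normalized score are asymptotically equivalent. -/
theorem IsSample.tendstoInMeasure_normalizedEstimator_sub (h : IsSample P m Y X W θ₀)
    (hr : ∀ᵐ ω ∂P, ∀ i, ‖X i ω‖ ≤ r ∧ ‖W i ω‖ ≤ r) (hest : IsScoreEstimator P m Y X W θhat)
    (hconsistent : ∀ᵐ ω ∂P, Tendsto (fun n => θhat n ω) atTop (𝓝 θ₀)) {c : ℝ} (hc : 0 < c)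
    (hV : ∀ᶠ n : ℕ in atTop, ∀ u : Param p q,
      c * n * ‖u‖ ^ 2 ≤ ⟪u, toEuclideanCLM (𝕜 := ℝ) (fisherInfo P m Y X W θ₀ n) u⟫) :
    TendstoInMeasure P (normalizedEstimator m Y X W θ₀ θhat - fun n ω =>
      toEuclideanCLM (𝕜 := ℝ) (CFC.sqrt (fisherInfo P m Y X W θ₀ n))⁻¹
        (trueScore m Y X W θ₀ n ω)) atTop 0 := by
  obtain ⟨M, hM⟩ := h.trials_bdd
  obtain ⟨K, hK, hb⟩ := exists_bound_obsScore θ₀ M r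
  obtain ⟨C, hC, hCae⟩ := h.ae_abs_obsHess_le hr
  have hlln := h.tendstoInMeasure_observedInfo_sub hr
  rw [tendstoInMeasure_iff_norm] at hlln ⊢
  intro η hη
  rw [ENNReal.tendsto_nhds_zero]
  intro δ hδ
  -- There are three bad events: failure of the linearization, a large deviation of the observed
  -- information at θ₀ from V, and a large score.
  have hδ3 : 0 < δ / 3 := ENNReal.div_pos hδ.ne' (by norm_num)
  -- a level `B` exceeded by the normalized score with small probability
  obtain ⟨B, hB0, hB⟩ : ∃ B : ℝ, 0 < B ∧
      ENNReal.ofReal (Fintype.card (Fin p ⊕ Fin q) * K ^ 2 / B ^ 2) ≤ δ / 3 := by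
    have h1 : Tendsto (fun B : ℝ => Fintype.card (Fin p ⊕ Fin q) * K ^ 2 / B ^ 2) atTop (𝓝 0) :=
      (tendsto_pow_atTop two_ne_zero).const_div_atTop _
    have h2 := ENNReal.tendsto_ofReal h1
    rw [ENNReal.ofReal_zero] at h2
    exact ((eventually_gt_atTop 0).and (ENNReal.tendsto_nhds_zero.1 h2 _ hδ3)).exists
  -- a bound `ε` for the errors which makes the difference smaller than `η`
  obtain ⟨ε, hε0, hεc, hε⟩ : ∃ ε : ℝ, 0 < ε ∧ 2 * ε ≤ c / 4 ∧
      2 / (c * √c) * (√(2 * ε * (C + ε)) + 2 * ε) * B < η := by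
    have h1 : Continuous fun ε : ℝ => 2 / (c * √c) * (√(2 * ε * (C + ε)) + 2 * ε) * B := by
      fun_prop
    have h2 := (h1.tendsto 0).mono_left (nhdsWithin_le_nhds (s := Set.Ioi 0))
    have h3 : Tendsto (fun ε : ℝ => 2 * ε) (𝓝[>] 0) (𝓝 (2 * 0)) :=
      ((continuous_const.mul continuous_id).tendsto 0).mono_left nhdsWithin_le_nhds
    obtain ⟨ε, h4, h5, h6⟩ := (eventually_mem_nhdsWithin.and
      ((h3.eventually_le_const (u := c / 4) (by simpa using hc)).and
        (h2.eventually_lt_const (u := η) (by simpa using hη)))).exists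
    exact ⟨ε, h4, h5, h6⟩
  filter_upwards [hV, eventually_gt_atTop 0, ENNReal.tendsto_nhds_zero.1
    (h.tendsto_measure_not_linearization hr hest hconsistent hε0) _ hδ3,
    ENNReal.tendsto_nhds_zero.1 (hlln ε hε0) _ hδ3] with n hVn hn hn1 hn2
  have hn' : (0 : ℝ) < n := by exact_mod_cast hn
  have hn3 : P {ω | B ≤ ‖trueScore m Y X W θ₀ n ω‖ / √n} ≤ δ / 3 := by
    refine (measure_norm_sum_ge_le (fun i => ?_) ?_ (fun i => ?_)
      (fun i u => h.integral_inner_obsScore hr i u) hn hB0).trans hB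
    · exact measurable_obsScore (m i) (h.measurable_Y i) measurable_const (h.measurable_X i)
        (h.measurable_W i)
    · exact h.indep.comp (fun i t => obsScore (m i) t.1 t.2.1 t.2.2 θ₀) fun i =>
        measurable_obsScore (m i) measurable_fst measurable_const
          (measurable_fst.comp measurable_snd) (measurable_snd.comp measurable_snd)
    · filter_upwards [hr] with ω hω
      exact hb _ (hM i) _ _ _ (hω i).1 (hω i).2
  have hpd := posDef_of_le_inner (isHermitian_fisherInfo n) (by positivity) hVn
  simp only [Pi.zero_apply, sub_zero] at hn2 ⊢
  refine (measure_mono_ae (t := _ ∪ (_ ∪ _)) ?_).trans <| (measure_union_le _ _).trans <|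
    (add_le_add hn1 ((measure_union_le _ _).trans (add_le_add hn2 hn3))).trans ?_
  · filter_upwards [hCae] with ω hω hbad
    by_contra hcon
    obtain ⟨hlin, herr, hsc⟩ : ω ∉ _ ∧ ω ∉ _ ∧ ω ∉ _ :=
      ⟨fun hlin => hcon (.inl hlin), fun herr => hcon (.inr (.inl herr)),
        fun hsc => hcon (.inr (.inr hsc))⟩
    obtain ⟨g1, g2⟩ := not_not.1 (mt Set.mem_ofPred_eq.mpr hlin)
    have g3 := lt_of_not_ge (mt Set.mem_ofPred_eq.mpr herr)
    have g4 := lt_of_not_ge (mt Set.mem_ofPred_eq.mpr hsc)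
    rw [Real.norm_of_nonneg (by positivity), div_lt_iff₀ hn'] at g3
    refine absurd hbad (not_le.2 ?_)
    set A := observedInfo m (Y · ω) (X · ω) (W · ω) n (θhat n ω) with hA
    set V := fisherInfo P m Y X W θ₀ n with hVdef
    rw [map_sub] at g1
    -- One ε for passing from θ̂ to θ₀, one for passing from the observed to the Fisher information.
    have hAV : ‖toEuclideanCLM (𝕜 := ℝ) A - toEuclideanCLM (𝕜 := ℝ) V‖ ≤ 2 * ε * n := by
      refine (norm_sub_le_norm_sub_add_norm_sub _ (toEuclideanCLM (𝕜 := ℝ)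
        (observedInfo m (Y · ω) (X · ω) (W · ω) n θ₀)) _).trans ?_
      linarith
    have hA0 : ‖toEuclideanCLM (𝕜 := ℝ) (observedInfo m (Y · ω) (X · ω) (W · ω) n θ₀)‖ ≤
        C * n := by
      rw [observedInfo_eq_neg_sum, map_neg, norm_neg, map_sum]
      refine (norm_sum_le_of_le _ fun i _ => hω i).trans ?_
      simp [mul_comm]
    have hAup : ‖toEuclideanCLM (𝕜 := ℝ) A‖ ≤ (C + ε) * n := by
      have := norm_le_norm_add_norm_sub' (toEuclideanCLM (𝕜 := ℝ) A)
        (toEuclideanCLM (𝕜 := ℝ) (observedInfo m (Y · ω) (X · ω) (W · ω) n θ₀))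
      linarith
    -- On the good event A inherits positivity from V, because 2 ε ≤ c. Hence `CFC.sqrt A` is the
    -- true square root and not its default value 0.
    have hAps : A.PosSemidef := by
      refine posSemidef_iff_inner.2 ⟨isHermitian_observedInfo _, fun u => ?_⟩
      have h1 := hVn u
      have h2 := (abs_le.1 (abs_inner_toEuclideanCLM_le (A - V) u)).1
      rw [map_sub, _root_.sub_apply, inner_sub_right] at h2
      have h3 : ‖toEuclideanCLM (𝕜 := ℝ) A - toEuclideanCLM (𝕜 := ℝ) V‖ * ‖u‖ ^ 2 ≤
          c * n * ‖u‖ ^ 2 := by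
        gcongr
        refine hAV.trans ?_
        gcongr
        linarith
      linarith
    have hmain := norm_sqrt_apply_sub_le hAps hpd.posSemidef hc (by positivity : 0 ≤ C + ε) hn'
      (by positivity) hεc hVn hAup hAV (h := θhat n ω - θ₀)
      (toEuclideanCLM_sqrt_inv_apply hpd (trueScore m Y X W θ₀ n ω)) (g2.trans (by
        gcongr; linarith))
    refine lt_of_le_of_lt hmain (lt_of_le_of_lt ?_ hε)
    gcongr
  · rw [← add_assoc, ENNReal.add_thirds]

end Normality

end ProbitZIB

end

theorem theorem2 {Ω : Type*} [MeasurableSpace Ω] (P : Measure Ω) [IsProbabilityMeasure P]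
    {p q : ℕ} [NeZero p] [NeZero q]
    (m : ℕ → ℕ) (Y : ℕ → Ω → ℕ)
    (X : ℕ → Ω → EuclideanSpace ℝ (Fin p)) (W : ℕ → Ω → EuclideanSpace ℝ (Fin q))
    (θ₀ : ProbitZIB.Param p q) (θhat : ℕ → Ω → ProbitZIB.Param p q)
    (hsample : ProbitZIB.IsSample P m Y X W θ₀)
    (hX : ProbitZIB.RegularCovariates P X) (hW : ProbitZIB.RegularCovariates P W)
    (hθ₀ : ProbitZIB.InteriorParam θ₀)
    (hcond : ProbitZIB.WellConditioned P m Y X W θ₀)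
    (hest : ProbitZIB.IsScoreEstimator P m Y X W θhat)
    (hconsistent : ∀ᵐ ω ∂P, Tendsto (fun n => θhat n ω) atTop (𝓝 θ₀)) :
    TendstoInDistribution (ProbitZIB.normalizedEstimator m Y X W θ₀ θhat) atTop
      (fun z : ProbitZIB.Param p q => z) (fun _ => P)
      (multivariateGaussian 0 (1 : Matrix (Fin p ⊕ Fin q) (Fin p ⊕ Fin q) ℝ)) := by
  obtain ⟨r, hr⟩ := ProbitZIB.exists_norm_covariates_le hX hW
  obtain ⟨c, hc, hV⟩ := hsample.exists_eventually_le_inner_fisherInfo hr hcond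
  -- Slutsky: the normalized estimator and the normalized score have the same limit in distribution.
  have hclt := tendstoInDistribution_of_tendstoInMeasure_sub
    (ProbitZIB.normalizedEstimator m Y X W θ₀ θhat) _
    (hsample.tendstoInDistribution_trueScore hr hc hV)
    (hsample.tendstoInMeasure_normalizedEstimator_sub hr hest hconsistent hc hV)
    fun n => (hsample.measurable_normalizedEstimator hest.measurable n).aemeasurable
  -- The statement carries an instance that the limit is a probability measure; generalizing the
  -- measure together with its instance allows the identification with `stdGaussian` by
  -- substitution.
  suffices key : ∀ (ν : Measure (ProbitZIB.Param p q)) [IsProbabilityMeasure ν],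
      ν = stdGaussian (ProbitZIB.Param p q) →
      TendstoInDistribution (ProbitZIB.normalizedEstimator m Y X W θ₀ θhat) atTop
        (fun z : ProbitZIB.Param p q => z) (fun _ => P) ν from
    key _ multivariateGaussian_zero_one
  rintro ν _ rfl
  exact hclt
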